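/- **Conventions.** All C*-algebras are over $\mathbb C$. For a unital C*-algebra $\mathfrak A$, $\mathfrak{sa}(\mathfrak A)$ is the real space of its self-adjoint elements and $\mathscr S(\mathfrak A)$ its state space; put $a\circ b=\tfrac12(ab+ba)$ and $\{a,b\}=\tfrac1{2i}(ab-ba)$. A function $F:[0,\infty)^4\to[0,\infty)$ is *permissible* if it is nondecreasing in each variable and $x\,l_y+y\,l_x\le F(x,y,l_x,l_y)$ for all arguments. For $C\ge 1$, $D\ge 0$ put $F_{C,D}(x,y,l_x,l_y)=C(x\,l_y+y\,l_x)+D\,l_xl_y$. **Quantum compact metric spaces.** An *$F$-quasi-Leibniz quantum compact metric space*, for a permissible $F$, is a pair $(\mathfrak A,\mathsf L)$ of a unital C*-algebra $\mathfrak A$ and a seminorm $\mathsf L$ on a dense real subspace $\mathrm{dom}(\mathsf L)$ of $\mathfrak{sa}(\mathfrak A)$ closed under $\circ$ and $\{\cdot,\cdot\}$ (extended by $\mathsf L=\infty$ off $\mathrm{dom}(\mathsf L)$) such that: $\{a:\mathsf L(a)=0\}=\mathbb R1_{\mathfrak A}$; $\{a\in\mathfrak{sa}(\mathfrak A):\mathsf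 L(a)\le1\}$ is norm closed; $\mathsf{mk}_{\mathsf L}(\varphi,\psi)=\sup\{|\varphi(a)-\psi(a)|:a\in\mathrm{dom}(\mathsf L),\ \mathsf L(a)\le1\}$ is a (finite) metric on $\mathscr S(\mathfrak A)$ inducing the weak* topology; and both $\mathsf L(a\circ b)$ and $\mathsf L(\{a,b\})$ are at most $F(\|a\|,\|b\|,\mathsf L(a),\mathsf L(b))$ for $a,b\in\mathrm{dom}(\mathsf L)$. It is *$(C,D)$-quasi-Leibniz* if this holds with $F=F_{C,D}$, and *Leibniz* if it holds with $F(x,y,l_x,l_y)=x\,l_y+y\,l_x$. It is *finite dimensional* if $\mathfrak A$ is. **Dual propinquity.** An *$F$-tunnel* from $(\mathfrak A_1,\mathsf L_1)$ to $(\mathfrak A_2,\mathsf L_2)$ is an $F$-quasi-Leibniz quantum compact metric space $(\mathfrak D,\mathsf L_{\mathfrak D})$ with surjective *-homomorphisms $\pi_j:\mathfrak D\to\mathfrak A_j$, $j=1,2$, such that $\mathsf L_j(a)=\inf\{\mathsf L_{\mathfrak D}(d):d\in\mathfrak{sa}(\mathfrak D),\ \pi_j(d)=a\}$ for all $a\in\mathfrak{sa}(\mathfrak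 A_j)$. Its *extent* is the maximum over $j\in\{1,2\}$ of the Hausdorff distance, for $\mathsf{mk}_{\mathsf L_{\mathfrak D}}$, between $\mathscr S(\mathfrak D)$ and $\{\varphi\circ\pi_j:\varphi\in\mathscr S(\mathfrak A_j)\}$. The *$(C,D)$-dual propinquity* $\Lambda_{C,D}$ between two $(C,D)$-quasi-Leibniz quantum compact metric spaces is the infimum of the extents of all $F_{C,D}$-tunnels between them. **Algebras.** A unital C*-algebra $\mathfrak A$ is *pseudo-diagonal* if for every $\varepsilon>0$ and every finite $\mathfrak F\subseteq\mathfrak A$ there are a finite dimensional C*-algebra $\mathfrak B$ and positive unital linear maps $\varphi:\mathfrak B\to\mathfrak A$, $\psi:\mathfrak A\to\mathfrak B$ with $\|a-\varphi(\psi(a))\|\le\varepsilon$, $\|\psi(a\circ b)-\psi(a)\circ\psi(b)\|\le\varepsilon$ and $\|\psi(\{a,b\})-\{\psi(a),\psi(b)\}\|\le\varepsilon$ for all $a,b\in\mathfrak F$. It is *nuclear* if for every $\varepsilon>0$ and finite $\mathfrak F\subseteq\mathfrak A$ there are $n$ and contractive completely positive maps $\psi:\mathfrak A\to M_n(\mathbb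 C)$, $\varphi:M_n(\mathbb C)\to\mathfrak A$ with $\|a-\varphi(\psi(a))\|\le\varepsilon$ for $a\in\mathfrak F$. It is *quasi-diagonal* if for every $\varepsilon>0$ and finite $\mathfrak F\subseteq\mathfrak A$ there are $n$ and a contractive completely positive map $\psi:\mathfrak A\to M_n(\mathbb C)$ with $\|\psi(ab)-\psi(a)\psi(b)\|\le\varepsilon$ and $\|a\|\le\|\psi(a)\|+\varepsilon$ for all $a,b\in\mathfrak F$. **Theorem.** Let $C\ge1$, $D\ge0$, and let $(\mathfrak A,\mathsf L)$ be a $(C,D)$-quasi-Leibniz quantum compact metric space. 1. If $\mathfrak A$ is pseudo-diagonal, then for every $\varepsilon>0$, $(\mathfrak A,\mathsf L)$ is a $(C(1+\varepsilon),D+\varepsilon)$-quasi-Leibniz quantum compact metric space and there is a sequence $(\mathfrak B_n,\mathsf L_n)_{n\in\mathbb N}$ of finite dimensional $(C(1+\varepsilon),D+\varepsilon)$-quasi-Leibniz quantum compact metric spaces with $\lim_{n\to\infty}\Lambda_{C(1+\varepsilon),\,D+\varepsilon}\big((\mathfrak A,\mathsf L),(\mathfrak B_n,\mathsf L_n)\big)=0$.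 2. The same conclusion holds if $\mathfrak A$ is nuclear and quasi-diagonal. In particular, if $(\mathfrak A,\mathsf L)$ is a Leibniz quantum compact metric space with $\mathfrak A$ nuclear and quasi-diagonal, then for every $\varepsilon>0$ it is a limit, for $\Lambda_{1+\varepsilon,\,\varepsilon}$, of a sequence of finite dimensional $(1+\varepsilon,\varepsilon)$-quasi-Leibniz quantum compact metric spaces. -/

import Mathlib

open Filter Topology
open scoped NNReal ENNReal

universe u

noncomputable section

namespace QuantumMetric

open scoped CStarAlgebra ComplexOrder

/-! ### Jordan and Lie products -/

section Products

variable {A : Type u} [CStarAlgebra A]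

/-- The Jordan product `(ab + ba) / 2`. -/
def jordan (a b : A) : A := (2⁻¹ : ℂ) • (a * b + b * a)

/-- The Lie product `(ab - ba) / (2i)`. -/
def lie (a b : A) : A := ((2 * Complex.I)⁻¹ : ℂ) • (a * b - b * a)

lemma jordan_mem (a b : selfAdjoint A) : jordan (a : A) (b : A) ∈ selfAdjoint A := by
  rw [selfAdjoint.mem_iff]
  simp [jordan, star_smul, a.2.star_eq, b.2.star_eq, add_comm]

lemma lie_mem (a b : selfAdjoint A) : lie (a : A) (b : A) ∈ selfAdjoint A := by
  rw [selfAdjoint.mem_iff]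
  simp only [lie, star_smul, star_sub, star_mul, a.2.star_eq, b.2.star_eq]
  rw [← neg_sub ((a : A) * b), smul_neg, ← neg_smul]
  congr 1
  simp

/-- The Jordan product of two self-adjoint elements, as a self-adjoint element. -/
def saJordan (a b : selfAdjoint A) : selfAdjoint A := ⟨jordan (a : A) (b : A), jordan_mem a b⟩

/-- The Lie product of two self-adjoint elements, as a self-adjoint element. -/
def saLie (a b : selfAdjoint A) : selfAdjoint A := ⟨lie (a : A) (b : A), lie_mem a b⟩

end Products

/-! ### States and the Monge-Kantorovich metric -/

/-- The set of states of a unital C*-algebra: positive unital continuous linear functionals. -/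
def stateSet (A : Type u) [CStarAlgebra A] : Set (WeakDual ℂ A) :=
  {φ | φ 1 = 1 ∧ ∀ a : A, 0 ≤ φ (star a * a)}

/-- The state space of a unital C*-algebra; its topology as a subtype is the weak* topology. -/
abbrev State (A : Type u) [CStarAlgebra A] : Type u := stateSet A

/-- The pullback `φ ↦ φ ∘ π` of states along a unital *-homomorphism. -/
def State.pullback {A B : Type u} [CStarAlgebra A] [CStarAlgebra B] (π : A →⋆ₐ[ℂ] B)
    (φ : State B) : State A :=
  ⟨StrongDual.toWeakDual ((WeakDual.toStrongDual φ.1).comp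
      (⟨π.toAlgHom.toLinearMap, map_continuous π⟩ : A →L[ℂ] B)), by
    constructor
    · change φ.1 (π 1) = 1
      rw [map_one]; exact φ.2.1
    · intro a
      change 0 ≤ φ.1 (π (star a * a))
      rw [map_mul, map_star]; exact φ.2.2 (π a)⟩

@[simp] lemma State.pullback_apply {A B : Type u} [CStarAlgebra A] [CStarAlgebra B]
    (π : A →⋆ₐ[ℂ] B) (φ : State B) (a : A) : (State.pullback π φ).1 a = φ.1 (π a) := rfl

/-- The Monge-Kantorovich distance `sup {|φ(a) - ψ(a)| : L(a) ≤ 1}` of two states. -/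
def mkDist {A : Type u} [CStarAlgebra A] (L : selfAdjoint A → ℝ≥0∞) (φ ψ : State A) : ℝ≥0∞ :=
  ⨆ (a : selfAdjoint A) (_ : L a ≤ 1), ENNReal.ofReal ‖φ.1 (a : A) - ψ.1 (a : A)‖

/-- The Monge-Kantorovich distance as an extended pseudo-metric (with its own topology) on the
state space. -/
@[reducible] def mkMetric {A : Type u} [CStarAlgebra A] (L : selfAdjoint A → ℝ≥0∞) :
    PseudoEMetricSpace (State A) where
  edist := mkDist L
  edist_self φ := by simp [mkDist]
  edist_comm φ ψ := by simp only [mkDist, norm_sub_rev]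
  edist_triangle φ ψ χ := by
    refine iSup₂_le fun a ha => ?_
    refine le_trans ?_ (add_le_add
      (le_iSup₂ (f := fun (a : selfAdjoint A) (_ : L a ≤ 1) =>
        ENNReal.ofReal ‖φ.1 (a : A) - ψ.1 (a : A)‖) a ha)
      (le_iSup₂ (f := fun (a : selfAdjoint A) (_ : L a ≤ 1) =>
        ENNReal.ofReal ‖ψ.1 (a : A) - χ.1 (a : A)‖) a ha))
    rw [← ENNReal.ofReal_add (norm_nonneg _) (norm_nonneg _)]
    exact ENNReal.ofReal_le_ofReal (norm_sub_le_norm_sub_add_norm_sub _ _ _)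

/-- The Hausdorff distance, for the Monge-Kantorovich metric of `L`, of two sets of states. -/
def mkHausdorff {A : Type u} [CStarAlgebra A] (L : selfAdjoint A → ℝ≥0∞)
    (s t : Set (State A)) : ℝ≥0∞ :=
  @Metric.hausdorffEDist (State A) (mkMetric L) s t

/-! ### Quasi-Leibniz quantum compact metric spaces -/

/-- Permissible functions `[0,∞)⁴ → [0,∞)`. -/
structure IsPermissible (F : ℝ≥0 → ℝ≥0 → ℝ≥0 → ℝ≥0 → ℝ≥0) : Prop where
  mono : ∀ ⦃x x' y y' lx lx' ly ly' : ℝ≥0⦄, x ≤ x' → y ≤ y' → lx ≤ lx' → ly ≤ ly' →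
    F x y lx ly ≤ F x' y' lx' ly'
  leibniz_le : ∀ x y lx ly : ℝ≥0, x * ly + y * lx ≤ F x y lx ly

/-- The function `C (x l_y + y l_x) + D l_x l_y`. -/
def cdFun (C D : ℝ≥0) : ℝ≥0 → ℝ≥0 → ℝ≥0 → ℝ≥0 → ℝ≥0 :=
  fun x y lx ly => C * (x * ly + y * lx) + D * lx * ly

/-- The function `x l_y + y l_x`. -/
def leibnizFun : ℝ≥0 → ℝ≥0 → ℝ≥0 → ℝ≥0 → ℝ≥0 :=
  fun x y lx ly => x * ly + y * lx

/-- A pair of a unital C*-algebra and a function `[0,∞]`-valued on its self-adjoint part (meant as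
a seminorm on the subspace where it is finite, extended by `∞`). -/
structure CStarPair : Type (u + 1) where
  carrier : Type u
  [cstar : CStarAlgebra carrier]
  lip : selfAdjoint carrier → ℝ≥0∞

attribute [instance] CStarPair.cstar

instance : CoeSort CStarPair.{u} (Type u) := ⟨CStarPair.carrier⟩

/-- `X` is an `F`-quasi-Leibniz quantum compact metric space. The domain of the seminorm is
`{a | X.lip a < ∞}`; it is a real subspace by the first two clauses, and it is closed under the
Jordan and Lie products by the last two. -/
structure IsQuasiLeibnizQCMS (F : ℝ≥0 → ℝ≥0 → ℝ≥0 → ℝ≥0 → ℝ≥0) (X : CStarPair.{u}) :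
    Prop where
  permissible : IsPermissible F
  lip_add : ∀ a b : selfAdjoint X, X.lip (a + b) ≤ X.lip a + X.lip b
  lip_smul : ∀ (r : ℝ) (a : selfAdjoint X), X.lip (r • a) = ENNReal.ofReal |r| * X.lip a
  dense_domain : Dense {a : selfAdjoint X | X.lip a < ∞}
  lip_eq_zero : ∀ a : selfAdjoint X, X.lip a = 0 ↔ ∃ r : ℝ, a = r • (1 : selfAdjoint X)
  closed_ball : IsClosed {a : selfAdjoint X | X.lip a ≤ 1}
  mk_finite : ∀ φ ψ : State X, mkDist X.lip φ ψ < ∞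
  mk_topology : (mkMetric X.lip).toUniformSpace.toTopologicalSpace =
    (instTopologicalSpaceSubtype : TopologicalSpace (State X))
  lip_jordan : ∀ a b : selfAdjoint X, X.lip a < ∞ → X.lip b < ∞ →
    X.lip (saJordan a b) ≤ F ‖(a : X)‖₊ ‖(b : X)‖₊ (X.lip a).toNNReal (X.lip b).toNNReal
  lip_lie : ∀ a b : selfAdjoint X, X.lip a < ∞ → X.lip b < ∞ →
    X.lip (saLie a b) ≤ F ‖(a : X)‖₊ ‖(b : X)‖₊ (X.lip a).toNNReal (X.lip b).toNNReal

/-- `(C,D)`-quasi-Leibniz quantum compact metric spaces. -/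
abbrev IsCDQuasiLeibnizQCMS (C D : ℝ≥0) (X : CStarPair.{u}) : Prop :=
  IsQuasiLeibnizQCMS (cdFun C D) X

/-- Leibniz quantum compact metric spaces. -/
abbrev IsLeibnizQCMS (X : CStarPair.{u}) : Prop := IsQuasiLeibnizQCMS leibnizFun X

/-! ### Tunnels and the dual propinquity -/

/-- An `F`-tunnel from `X` to `Y`. -/
structure Tunnel (F : ℝ≥0 → ℝ≥0 → ℝ≥0 → ℝ≥0 → ℝ≥0) (X Y : CStarPair.{u}) :
    Type (u + 1) where
  space : CStarPair.{u}
  isQCMS : IsQuasiLeibnizQCMS F space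
  left : space →⋆ₐ[ℂ] X
  right : space →⋆ₐ[ℂ] Y
  left_surjective : Function.Surjective left
  right_surjective : Function.Surjective right
  left_quotient : ∀ a : selfAdjoint X,
    X.lip a = ⨅ (d : selfAdjoint space) (_ : left (d : space) = (a : X)), space.lip d
  right_quotient : ∀ b : selfAdjoint Y,
    Y.lip b = ⨅ (d : selfAdjoint space) (_ : right (d : space) = (b : Y)), space.lip d

/-- The extent of a tunnel. -/
def Tunnel.extent {F : ℝ≥0 → ℝ≥0 → ℝ≥0 → ℝ≥0 → ℝ≥0} {X Y : CStarPair.{u}}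
    (τ : Tunnel F X Y) : ℝ≥0∞ :=
  max (mkHausdorff τ.space.lip Set.univ (Set.range (State.pullback τ.left)))
    (mkHausdorff τ.space.lip Set.univ (Set.range (State.pullback τ.right)))

/-- The dual propinquity, for the class of all `F`-tunnels, between two `F`-quasi-Leibniz quantum
compact metric spaces: the infimum of the extents of the `F`-tunnels between them. -/
def propinquity (F : ℝ≥0 → ℝ≥0 → ℝ≥0 → ℝ≥0 → ℝ≥0) (X Y : CStarPair.{u}) : ℝ≥0∞ :=
  ⨅ τ : Tunnel F X Y, τ.extent

/-- Among the `(C,D)`-quasi-Leibniz quantum compact metric spaces, with the `(C,D)`-dual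
propinquity, `X` is the limit of a sequence of finite dimensional ones. -/
def IsLimitOfFiniteDimensional (C D : ℝ≥0) (X : CStarPair.{u}) : Prop :=
  IsCDQuasiLeibnizQCMS C D X ∧
  ∃ Y : ℕ → CStarPair.{u},
    (∀ n, IsCDQuasiLeibnizQCMS C D (Y n) ∧ FiniteDimensional ℂ (Y n)) ∧
    Tendsto (fun n => propinquity (cdFun C D) X (Y n)) atTop (𝓝 0)

/-! ### Pseudo-diagonal, nuclear and quasi-diagonal C*-algebras -/

/-- Positive linear maps; the positive elements of a C*-algebra are those of the form `b* b`. -/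
def IsPositiveMap {A B : Type*} [CStarAlgebra A] [CStarAlgebra B] (φ : A →ₗ[ℂ] B) : Prop :=
  ∀ a : A, ∃ b : B, φ (star a * a) = star b * b

/-- Completely positive linear maps: all the entrywise extensions to matrices are positive. -/
def IsCompletelyPositive {A B : Type*} [CStarAlgebra A] [CStarAlgebra B]
    (φ : A →ₗ[ℂ] B) : Prop :=
  ∀ (k : ℕ) (M : CStarMatrix (Fin k) (Fin k) A), ∃ N : CStarMatrix (Fin k) (Fin k) B,
    (star M * M).map φ = star N * N

/-- Contractive completely positive linear maps. -/
def IsCCP {A B : Type*} [CStarAlgebra A] [CStarAlgebra B] (φ : A →ₗ[ℂ] B) : Prop :=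
  IsCompletelyPositive φ ∧ ∀ a : A, ‖φ a‖ ≤ ‖a‖

/-- Pseudo-diagonal unital C*-algebras. -/
def IsPseudoDiagonal (A : Type u) [CStarAlgebra A] : Prop :=
  ∀ ε : ℝ, 0 < ε → ∀ S : Finset A,
    ∃ (B : Type u) (_ : CStarAlgebra B) (_ : FiniteDimensional ℂ B)
      (φ : B →ₗ[ℂ] A) (ψ : A →ₗ[ℂ] B),
      IsPositiveMap φ ∧ φ 1 = 1 ∧ IsPositiveMap ψ ∧ ψ 1 = 1 ∧
      (∀ a ∈ S, ‖a - φ (ψ a)‖ ≤ ε) ∧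
      (∀ a ∈ S, ∀ b ∈ S, ‖ψ (jordan a b) - jordan (ψ a) (ψ b)‖ ≤ ε) ∧
      (∀ a ∈ S, ∀ b ∈ S, ‖ψ (lie a b) - lie (ψ a) (ψ b)‖ ≤ ε)

/-- Nuclear C*-algebras: the identity map is a point-norm limit of contractive completely
positive maps that factor, through contractive completely positive maps, through full matrix
algebras. -/
def IsNuclear (A : Type u) [CStarAlgebra A] : Prop :=
  ∀ ε : ℝ, 0 < ε → ∀ S : Finset A,
    ∃ (n : ℕ) (ψ : A →ₗ[ℂ] CStarMatrix (Fin n) (Fin n) ℂ)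
      (φ : CStarMatrix (Fin n) (Fin n) ℂ →ₗ[ℂ] A),
      IsCCP ψ ∧ IsCCP φ ∧ ∀ a ∈ S, ‖a - φ (ψ a)‖ ≤ ε

/-- Quasi-diagonal C*-algebras: there are contractive completely positive maps into full matrix
algebras that are asymptotically multiplicative and asymptotically isometric. -/
def IsQuasiDiagonal (A : Type u) [CStarAlgebra A] : Prop :=
  ∀ ε : ℝ, 0 < ε → ∀ S : Finset A,
    ∃ (n : ℕ) (ψ : A →ₗ[ℂ] CStarMatrix (Fin n) (Fin n) ℂ),
      IsCCP ψ ∧ (∀ a ∈ S, ∀ b ∈ S, ‖ψ (a * b) - ψ a * ψ b‖ ≤ ε) ∧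
      ∀ a ∈ S, ‖a‖ ≤ ‖ψ a‖ + ε

end QuantumMetric

end

open QuantumMetric

/-!
If the identity of `A` approximately factors through a finite dimensional algebra `B` by unital
positive maps `ψ : A → B` and `φ : B → A`, with `ψ` almost multiplicative for the Jordan and Lie
products, then `A × B` with the seminorm `(a, b) ↦ max (L a) (δ⁻¹ ‖ψ a - b‖)` is a short tunnel from
`A` to its quotient `B`: states are transported by composition with `φ` and `ψ`. Modulo scalars the
unit ball of a Lip-norm is totally bounded, so that pseudo-diagonality makes the errors uniformly
small there; the defect of `ψ` for the two products then only contributes to the term `D l_x l_y` of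
the Leibniz inequality.

Let `A` be nuclear and quasi-diagonal. Quasi-diagonality provides unital positive maps
`θ i : A → B i` into finite dimensional algebras that are asymptotically multiplicative and
isometric, and nuclearity provides factorizations of the identity through matrix algebras `M_k`. By
Choi's correspondence a completely positive map `α : A → M_k` is a positive functional on `M_k(A)`,
which extends approximately along the amplification of `θ i` by a separation argument. Hence `α`
almost factors through `θ i`, and so does the identity of `A`.
-/

noncomputable section

namespace QuantumMetric

open scoped CStarAlgebra ComplexOrder ComplexStarModule

attribute [local instance 10] CStarAlgebra.spectralOrder CStarAlgebra.spectralOrderedRing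

/-! ### Positive maps and states -/

section HermitianProducts

variable {A : Type*} [CStarAlgebra A]

/-- The Hermitian combination `c ab + c̄ ba`, which treats the Jordan product (`c = 1 / 2`) and the
Lie product (`c = 1 / (2i)`) at the same time. -/
def hermProd (c : ℂ) (a b : A) : A := c • (a * b) + star c • (b * a)

lemma hermProd_mem_selfAdjoint (c : ℂ) (a b : selfAdjoint A) :
    hermProd c (a : A) (b : A) ∈ selfAdjoint A := by
  rw [selfAdjoint.mem_iff]
  simp [hermProd, star_smul, a.2.star_eq, b.2.star_eq, add_comm]

/-- `hermProd` on the self-adjoint part. -/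
def saHermProd (c : ℂ) (a b : selfAdjoint A) : selfAdjoint A :=
  ⟨hermProd c (a : A) (b : A), hermProd_mem_selfAdjoint c a b⟩

/-- The coefficients for which `hermProd` is the Jordan product or the Lie product. -/
def jordanLieCoeffs : Set ℂ := {2⁻¹, (2 * Complex.I)⁻¹}

lemma norm_eq_of_mem_jordanLieCoeffs {c : ℂ} (hc : c ∈ jordanLieCoeffs) : ‖c‖ = 2⁻¹ := by
  rcases hc with rfl | rfl <;> simp

lemma hermProd_two_inv : hermProd (2⁻¹ : ℂ) = jordan (A := A) := by
  ext a b
  simp [hermProd, jordan]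

lemma hermProd_two_I_inv : hermProd (2 * Complex.I)⁻¹ = lie (A := A) := by
  ext a b
  simp [hermProd, lie, sub_eq_add_neg]

lemma forall_jordanLieCoeffs_saHermProd
    {P : (selfAdjoint A → selfAdjoint A → selfAdjoint A) → Prop} :
    (∀ c ∈ jordanLieCoeffs, P (saHermProd c)) ↔ P saJordan ∧ P saLie := by
  have hJ : saHermProd (A := A) 2⁻¹ = saJordan := by
    ext a b; exact congrFun₂ hermProd_two_inv (a : A) b
  have hL : saHermProd (A := A) (2 * Complex.I)⁻¹ = saLie := by
    ext a b; exact congrFun₂ hermProd_two_I_inv (a : A) b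
  simp [jordanLieCoeffs, ← hJ, ← hL]

variable {B : Type*} [CStarAlgebra B] {c : ℂ}

lemma norm_hermProd_sub_hermProd_le (hc : ‖c‖ ≤ 2⁻¹) (a a' b b' : A) :
    ‖hermProd c a b - hermProd c a' b'‖ ≤ ‖a‖ * ‖b - b'‖ + ‖a - a'‖ * ‖b'‖ := by
  have hab : ‖a * b - a' * b'‖ ≤ ‖a‖ * ‖b - b'‖ + ‖a - a'‖ * ‖b'‖ := by
    rw [show a * b - a' * b' = a * (b - b') + (a - a') * b' by noncomm_ring]
    exact norm_add_le_of_le (norm_mul_le _ _) (norm_mul_le _ _)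
  have hba : ‖b * a - b' * a'‖ ≤ ‖a‖ * ‖b - b'‖ + ‖a - a'‖ * ‖b'‖ := by
    rw [show b * a - b' * a' = (b - b') * a + b' * (a - a') by noncomm_ring, mul_comm ‖a‖,
      mul_comm ‖a - a'‖]
    exact norm_add_le_of_le (norm_mul_le _ _) (norm_mul_le _ _)
  calc ‖hermProd c a b - hermProd c a' b'‖
      = ‖c • (a * b - a' * b') + star c • (b * a - b' * a')‖ := by
        congr 1; simp only [hermProd, smul_sub]; abel
    _ ≤ ‖c‖ * ‖a * b - a' * b'‖ + ‖c‖ * ‖b * a - b' * a'‖ := by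
        refine (norm_add_le _ _).trans_eq ?_
        rw [norm_smul, norm_smul, norm_star]
    _ ≤ 2⁻¹ * (‖a‖ * ‖b - b'‖ + ‖a - a'‖ * ‖b'‖) + 2⁻¹ * (‖a‖ * ‖b - b'‖ + ‖a - a'‖ * ‖b'‖) := by
        gcongr
    _ = ‖a‖ * ‖b - b'‖ + ‖a - a'‖ * ‖b'‖ := by ring

lemma norm_map_hermProd_sub_le (ψ : A →ₗ[ℂ] B) (hc : ‖c‖ ≤ 2⁻¹) {a b : A} {δ : ℝ}
    (hab : ‖ψ (a * b) - ψ a * ψ b‖ ≤ δ) (hba : ‖ψ (b * a) - ψ b * ψ a‖ ≤ δ) :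
    ‖ψ (hermProd c a b) - hermProd c (ψ a) (ψ b)‖ ≤ δ := by
  calc ‖ψ (hermProd c a b) - hermProd c (ψ a) (ψ b)‖
      = ‖c • (ψ (a * b) - ψ a * ψ b) + star c • (ψ (b * a) - ψ b * ψ a)‖ := by
        congr 1; simp only [hermProd, map_add, map_smul, smul_sub]; abel
    _ ≤ ‖c‖ * ‖ψ (a * b) - ψ a * ψ b‖ + ‖c‖ * ‖ψ (b * a) - ψ b * ψ a‖ := by
        refine (norm_add_le _ _).trans_eq ?_
        rw [norm_smul, norm_smul, norm_star]
    _ ≤ 2⁻¹ * δ + 2⁻¹ * δ := by gcongr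
    _ = δ := by ring

lemma map_hermProd_add_smul_one_sub {ψ : A →ₗ[ℂ] B} (h1 : ψ 1 = 1) (a b : A) (r s : ℝ) :
    ψ (hermProd c (r • 1 + a) (s • 1 + b)) - hermProd c (ψ (r • 1 + a)) (ψ (s • 1 + b)) =
      ψ (hermProd c a b) - hermProd c (ψ a) (ψ b) := by
  simp only [hermProd, ← Complex.coe_smul, map_add, map_smul, h1, add_mul, mul_add,
    smul_mul_assoc, mul_smul_comm, one_mul, mul_one, smul_add, smul_smul]
  module

end HermitianProducts

section PositiveMaps

variable {A B C : Type*} [CStarAlgebra A] [CStarAlgebra B] [CStarAlgebra C]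

lemma isPositiveMap_iff [PartialOrder A] [StarOrderedRing A] [PartialOrder B] [StarOrderedRing B]
    {φ : A →ₗ[ℂ] B} : IsPositiveMap φ ↔ ∀ a, 0 ≤ a → 0 ≤ φ a := by
  simp only [IsPositiveMap, CStarAlgebra.nonneg_iff_eq_star_mul_self, forall_exists_index,
    forall_eq_apply_imp_iff]

lemma isPositiveMap_complex_iff {f : A →ₗ[ℂ] ℂ} : IsPositiveMap f ↔ ∀ a, 0 ≤ f (star a * a) :=
  forall_congr' fun _ => CStarAlgebra.nonneg_iff_eq_star_mul_self.symm

lemma norm_le_of_mem_Icc_algebraMap {a : A} {r : ℝ} (hr : 0 ≤ r)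
    (ha : a ∈ Set.Icc (-algebraMap ℝ A r) (algebraMap ℝ A r)) : ‖a‖ ≤ r := by
  have hsa : IsSelfAdjoint a := .of_ge ha.1 (IsSelfAdjoint.algebraMap A (.all r)).neg
  rcases subsingleton_or_nontrivial A with _ | _
  · simpa [Subsingleton.elim a 0] using hr
  rcases CStarAlgebra.norm_or_neg_norm_mem_spectrum hsa with h | h
  · exact (le_algebraMap_iff_spectrum_le hsa).1 ha.2 _ h
  · have hle := ha.1
    rw [← map_neg, algebraMap_le_iff_le_spectrum hsa] at hle
    exact neg_le_neg_iff.1 (hle _ h)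

namespace IsPositiveMap

lemma id : IsPositiveMap (LinearMap.id : A →ₗ[ℂ] A) := fun a => ⟨a, rfl⟩

lemma comp {φ : B →ₗ[ℂ] C} {ψ : A →ₗ[ℂ] B} (hφ : IsPositiveMap φ) (hψ : IsPositiveMap ψ) :
    IsPositiveMap (φ ∘ₗ ψ) :=
  isPositiveMap_iff.2 fun a ha => isPositiveMap_iff.1 hφ _ (isPositiveMap_iff.1 hψ a ha)

lemma add {φ ψ : A →ₗ[ℂ] B} (hφ : IsPositiveMap φ) (hψ : IsPositiveMap ψ) :
    IsPositiveMap (φ + ψ) :=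
  isPositiveMap_iff.2 fun a ha =>
    add_nonneg (isPositiveMap_iff.1 hφ a ha) (isPositiveMap_iff.1 hψ a ha)

variable {φ : A →ₗ[ℂ] B}

lemma smul (hφ : IsPositiveMap φ) {r : ℝ} (hr : 0 ≤ r) : IsPositiveMap ((r : ℂ) • φ) :=
  isPositiveMap_iff.2 fun a ha => by
    rw [LinearMap.smul_apply, Complex.coe_smul]
    exact smul_nonneg hr (isPositiveMap_iff.1 hφ a ha)

lemma mono (hφ : IsPositiveMap φ) {a b : A} (hab : a ≤ b) : φ a ≤ φ b := by
  rw [← sub_nonneg, ← map_sub]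
  exact isPositiveMap_iff.1 hφ _ (sub_nonneg.2 hab)

lemma isSelfAdjoint_map (hφ : IsPositiveMap φ) {a : A} (ha : IsSelfAdjoint a) :
    IsSelfAdjoint (φ a) :=
  ha.map' (PositiveLinearMap.mk₀ φ (isPositiveMap_iff.1 hφ))

lemma map_star (hφ : IsPositiveMap φ) (a : A) : φ (star a) = star (φ a) :=
  StarHomClass.map_star (PositiveLinearMap.mk₀ φ (isPositiveMap_iff.1 hφ)) a

lemma norm_map_le (hφ : IsPositiveMap φ) {a : A} (ha : IsSelfAdjoint a) :
    ‖φ a‖ ≤ ‖φ 1‖ * ‖a‖ := by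
  have hle : φ (algebraMap ℝ A ‖a‖) ≤ algebraMap ℝ B (‖φ 1‖ * ‖a‖) := by
    rw [Algebra.algebraMap_eq_smul_one, ← Complex.coe_smul, map_smul, Complex.coe_smul, mul_comm,
      map_mul, ← Algebra.smul_def]
    exact smul_le_smul_of_nonneg_left
      (hφ.isSelfAdjoint_map (.one A)).le_algebraMap_norm_self (norm_nonneg _)
  refine norm_le_of_mem_Icc_algebraMap (by positivity)
    ⟨(neg_le_neg hle).trans ?_, (hφ.mono ha.le_algebraMap_norm_self).trans hle⟩
  rw [← map_neg]
  exact hφ.mono ha.neg_algebraMap_norm_le_self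

lemma norm_map_le_two_mul (hφ : IsPositiveMap φ) (a : A) : ‖φ a‖ ≤ 2 * ‖φ 1‖ * ‖a‖ := by
  have hre : ‖φ (ℜ a)‖ ≤ ‖φ 1‖ * ‖a‖ := (hφ.norm_map_le (ℜ a).2).trans <| by
    gcongr; exact realPart.norm_le a
  have him : ‖φ (ℑ a)‖ ≤ ‖φ 1‖ * ‖a‖ := (hφ.norm_map_le (ℑ a).2).trans <| by
    gcongr; exact imaginaryPart.norm_le a
  calc ‖φ a‖ = ‖φ (ℜ a) + Complex.I • φ (ℑ a)‖ := by
        rw [← map_smul, ← map_add, realPart_add_I_smul_imaginaryPart a]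
    _ ≤ ‖φ (ℜ a)‖ + ‖φ (ℑ a)‖ := (norm_add_le _ _).trans (by simp [norm_smul])
    _ ≤ 2 * ‖φ 1‖ * ‖a‖ := by linarith

lemma continuous (hφ : IsPositiveMap φ) : Continuous φ :=
  (LinearMap.mkContinuous φ _ hφ.norm_map_le_two_mul).continuous

end IsPositiveMap

/-- Unital positive linear maps. -/
structure IsUnitalPositiveMap (φ : A →ₗ[ℂ] B) : Prop where
  isPositiveMap : IsPositiveMap φ
  map_one : φ 1 = 1

namespace IsUnitalPositiveMap

lemma id : IsUnitalPositiveMap (LinearMap.id : A →ₗ[ℂ] A) := ⟨.id, rfl⟩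

lemma comp {φ : B →ₗ[ℂ] C} {ψ : A →ₗ[ℂ] B} (hφ : IsUnitalPositiveMap φ)
    (hψ : IsUnitalPositiveMap ψ) : IsUnitalPositiveMap (φ ∘ₗ ψ) :=
  ⟨hφ.isPositiveMap.comp hψ.isPositiveMap, by simp [hψ.map_one, hφ.map_one]⟩

variable {φ : A →ₗ[ℂ] B} (hφ : IsUnitalPositiveMap φ)
include hφ

lemma norm_map_le {a : A} (ha : IsSelfAdjoint a) : ‖φ a‖ ≤ ‖a‖ := by
  nontriviality B
  simpa [hφ.map_one] using hφ.isPositiveMap.norm_map_le ha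

lemma norm_map_le_two_mul (a : A) : ‖φ a‖ ≤ 2 * ‖a‖ := by
  nontriviality B
  simpa [hφ.map_one] using hφ.isPositiveMap.norm_map_le_two_mul a

lemma map_smul_one (r : ℝ) : φ (r • 1) = r • 1 := by
  rw [← Complex.coe_smul, map_smul, hφ.map_one, Complex.coe_smul]

end IsUnitalPositiveMap

end PositiveMaps

section States

variable {A : Type*} [CStarAlgebra A]

lemma norm_add_I_mul_smul_one_sq_le {a : A} (ha : IsSelfAdjoint a) (t : ℝ) :
    ‖a + (t * Complex.I) • (1 : A)‖ ^ 2 ≤ ‖a‖ ^ 2 + t ^ 2 := by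
  have hmul : star (a + (t * Complex.I) • (1 : A)) * (a + (t * Complex.I) • (1 : A)) =
      star a * a + ((t : ℂ) ^ 2) • (1 : A) := by
    have hI : -(t * Complex.I * (t * Complex.I)) = (t : ℂ) ^ 2 := by
      linear_combination -(t : ℂ) ^ 2 * Complex.I_mul_I
    simp only [star_add, star_smul, star_mul, ha.star_eq, star_one, Complex.star_def,
      Complex.conj_ofReal, Complex.conj_I, add_mul, mul_add, smul_mul_assoc, mul_smul_comm,
      one_mul, mul_one, ← hI]
    module
  have hone : ‖((t : ℂ) ^ 2) • (1 : A)‖ ≤ t ^ 2 := by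
    rcases subsingleton_or_nontrivial A with _ | _
    · simpa [Subsingleton.elim (1 : A) 0] using sq_nonneg t
    · simp [norm_smul]
  calc ‖a + (t * Complex.I) • (1 : A)‖ ^ 2 = ‖star a * a + ((t : ℂ) ^ 2) • (1 : A)‖ := by
        rw [sq, ← CStarRing.norm_star_mul_self, hmul]
    _ ≤ ‖a‖ ^ 2 + t ^ 2 := by
        rw [sq ‖a‖, ← CStarRing.norm_star_mul_self]
        exact norm_add_le_of_le le_rfl hone

/-- Otherwise the imaginary part of `f (a + i t)` would outgrow `‖a + i t‖` as `t → ±∞`. -/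
lemma im_apply_eq_zero_of_norm_le_one {f : A →L[ℂ] ℂ} (hf : ‖f‖ ≤ 1) (h1 : f 1 = 1) {a : A}
    (ha : IsSelfAdjoint a) : (f a).im = 0 := by
  have hbound (t : ℝ) : 2 * (f a).im * t + (f a).im ^ 2 ≤ ‖a‖ ^ 2 := by
    have him : ((f a).im + t) ^ 2 ≤ ‖a‖ ^ 2 + t ^ 2 := by
      calc ((f a).im + t) ^ 2 = (f (a + (t * Complex.I) • (1 : A))).im ^ 2 := by
            simp [h1]
        _ ≤ ‖f (a + (t * Complex.I) • (1 : A))‖ ^ 2 := sq_le_sq.2 <| by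
            rw [abs_norm]; exact Complex.abs_im_le_norm _
        _ ≤ ‖a + (t * Complex.I) • (1 : A)‖ ^ 2 := by
            gcongr; exact f.le_of_opNorm_le_of_le hf le_rfl |>.trans_eq (one_mul _)
        _ ≤ ‖a‖ ^ 2 + t ^ 2 := norm_add_I_mul_smul_one_sq_le ha t
    linarith
  by_contra hne
  have := hbound (‖a‖ ^ 2 / (2 * (f a).im))
  rw [mul_div_cancel₀ _ (by simpa using hne)] at this
  nlinarith [pow_pos (abs_pos.2 hne) 2, sq_abs (f a).im]

lemma isPositiveMap_of_norm_le_one {f : A →L[ℂ] ℂ} (hf : ‖f‖ ≤ 1) (h1 : f 1 = 1) :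
    IsPositiveMap (f : A →ₗ[ℂ] ℂ) := by
  refine isPositiveMap_iff.2 fun a ha => Complex.nonneg_iff.2
    ⟨?_, (im_apply_eq_zero_of_norm_le_one hf h1 ha.isSelfAdjoint).symm⟩
  have hnorm : ‖algebraMap ℝ A ‖a‖ - a‖ ≤ ‖a‖ := norm_le_of_mem_Icc_algebraMap (norm_nonneg a)
    ⟨(neg_nonpos.2 (algebraMap_nonneg A (norm_nonneg a))).trans
      (sub_nonneg.2 ha.isSelfAdjoint.le_algebraMap_norm_self), sub_le_self _ ha⟩
  have hre : ‖a‖ - (f a).re ≤ ‖a‖ := by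
    calc ‖a‖ - (f a).re = (f (algebraMap ℝ A ‖a‖ - a)).re := by
          rw [Algebra.algebraMap_eq_smul_one, ← Complex.coe_smul]
          simp [h1]
      _ ≤ ‖f (algebraMap ℝ A ‖a‖ - a)‖ := Complex.re_le_norm _
      _ ≤ 1 * ‖a‖ := f.le_of_opNorm_le_of_le hf hnorm
      _ = ‖a‖ := one_mul _
  simpa using hre

end States

namespace State

section

variable {A : Type u} [CStarAlgebra A]

/-- The positive linear functional underlying a state. -/
def toLinearMap (φ : State A) : A →ₗ[ℂ] ℂ := (WeakDual.toStrongDual φ.1).toLinearMap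

@[simp] lemma toLinearMap_apply (φ : State A) (a : A) : φ.toLinearMap a = φ.1 a := rfl

lemma isUnitalPositiveMap (φ : State A) : IsUnitalPositiveMap φ.toLinearMap :=
  ⟨isPositiveMap_complex_iff.2 φ.2.2, φ.2.1⟩

lemma map_one (φ : State A) : φ.1 1 = 1 := φ.2.1

lemma map_smul_one (φ : State A) (r : ℝ) : φ.1 (r • 1) = r :=
  (φ.isUnitalPositiveMap.map_smul_one r).trans (by simp)

lemma norm_apply_le (φ : State A) {a : A} (ha : IsSelfAdjoint a) : ‖φ.1 a‖ ≤ ‖a‖ :=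
  φ.isUnitalPositiveMap.norm_map_le ha

lemma coe_re_apply (φ : State A) {a : A} (ha : IsSelfAdjoint a) : ((φ.1 a).re : ℂ) = φ.1 a :=
  Complex.conj_eq_iff_re.1 (φ.isUnitalPositiveMap.isPositiveMap.isSelfAdjoint_map ha)

/-- The state given by a unital positive linear functional. -/
def ofUnitalPositiveMap {f : A →ₗ[ℂ] ℂ} (hf : IsUnitalPositiveMap f) : State A :=
  ⟨StrongDual.toWeakDual ⟨f, hf.isPositiveMap.continuous⟩, hf.map_one,
    isPositiveMap_complex_iff.1 hf.isPositiveMap⟩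

@[simp] lemma ofUnitalPositiveMap_apply {f : A →ₗ[ℂ] ℂ} (hf : IsUnitalPositiveMap f) (a : A) :
    (ofUnitalPositiveMap hf).1 a = f a := rfl

/-- Extend to `A` a character of the commutative C*-algebra generated by `a`. -/
lemma exists_apply_eq_of_mem_spectrum (a : A) [IsStarNormal a] {z : ℂ} (hz : z ∈ spectrum ℂ a) :
    ∃ φ : State A, φ.1 a = z := by
  let S := StarAlgebra.elemental ℂ a
  have : IsClosed (S : Set A) := StarAlgebra.elemental.isClosed ℂ a
  have : Nontrivial A := not_subsingleton_iff_nontrivial.1 fun _ => by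
    simp [spectrum.of_subsingleton] at hz
  let b : S := ⟨a, StarAlgebra.elemental.self_mem ℂ a⟩
  obtain ⟨χ, hχ⟩ := (WeakDual.CharacterSpace.mem_spectrum_iff_exists (a := b)).1 <| by
    rwa [StarSubalgebra.spectrum_eq]
  obtain ⟨f, hfχ, hnorm⟩ := exists_extension_norm_eq (Subalgebra.toSubmodule S.toSubalgebra)
    (WeakDual.toStrongDual (χ : WeakDual ℂ S))
  have h1 : f 1 = 1 := (hfχ ⟨1, one_mem S⟩).trans (_root_.map_one χ)
  have hf : ‖f‖ ≤ 1 :=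
    hnorm.le.trans ((WeakDual.CharacterSpace.norm_le_norm_one χ).trans_eq CStarRing.norm_one)
  exact ⟨ofUnitalPositiveMap ⟨isPositiveMap_of_norm_le_one hf h1, h1⟩, (hfχ b).trans hχ⟩

lemma exists_norm_apply_eq [Nontrivial A] {a : A} (ha : IsSelfAdjoint a) :
    ∃ φ : State A, ‖φ.1 a‖ = ‖a‖ := by
  have := ha.isStarNormal
  rcases CStarAlgebra.norm_or_neg_norm_mem_spectrum ha with h | h
  all_goals
    obtain ⟨φ, hφ⟩ := exists_apply_eq_of_mem_spectrum a (spectrum.algebraMap_mem ℂ h)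
    exact ⟨φ, by simp [hφ]⟩

instance [Nontrivial A] : Nonempty (State A) :=
  ⟨(exists_norm_apply_eq (.one A)).choose⟩

instance : CompactSpace (State A) := by
  refine isCompact_iff_compactSpace.1 <|
    (WeakDual.isCompact_closedBall (𝕜 := ℂ) (E := A) 0 2).of_isClosed_subset ?_ fun φ hφ => ?_
  · have hset : stateSet A = {φ | φ 1 = 1} ∩ ⋂ a : A, {φ | 0 ≤ φ (star a * a)} := by
      ext; simp [stateSet]
    rw [hset]
    exact (isClosed_eq (WeakDual.eval_continuous _) continuous_const).inter
      (isClosed_iInter fun a => isClosed_le continuous_const (WeakDual.eval_continuous _))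
  · simp only [Set.mem_preimage, Metric.mem_closedBall, dist_zero_right]
    exact ContinuousLinearMap.opNorm_le_bound _ zero_le_two
      (isUnitalPositiveMap ⟨φ, hφ⟩).norm_map_le_two_mul

end

/-- The pullback of states along a unital positive map. -/
def comp {A B : Type u} [CStarAlgebra A] [CStarAlgebra B] (φ : State B) {ψ : A →ₗ[ℂ] B}
    (hψ : IsUnitalPositiveMap ψ) : State A :=
  ofUnitalPositiveMap (φ.isUnitalPositiveMap.comp hψ)

@[simp] lemma comp_apply {A B : Type u} [CStarAlgebra A] [CStarAlgebra B] (φ : State B)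
    {ψ : A →ₗ[ℂ] B} (hψ : IsUnitalPositiveMap ψ) (a : A) : (φ.comp hψ).1 a = φ.1 (ψ a) := rfl

end State

/-! ### The Monge–Kantorovich metric and Lip-norms -/

lemma continuous_edist_of_topology_eq {X : Type*} [t : TopologicalSpace X]
    (d : PseudoEMetricSpace X) (h : d.toUniformSpace.toTopologicalSpace = t) (x : X) :
    Continuous fun y => d.edist y x := by
  subst h
  exact continuous_id.edist continuous_const

lemma t2Space_of_edist_eq_zero {X : Type*} (d : PseudoEMetricSpace X)
    (h0 : ∀ x y, d.edist x y = 0 → x = y) : T2Space X := by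
  have : T0Space X := ⟨fun x y hxy => h0 x y (EMetric.inseparable_iff.1 hxy)⟩
  infer_instance

/-- The identity is continuous from the compact topology `t` to the Hausdorff topology of `d`. -/
lemma topology_eq_of_eventually_edist_le {X : Type*} [t : TopologicalSpace X] [CompactSpace X]
    (d : PseudoEMetricSpace X) (h0 : ∀ x y, d.edist x y = 0 → x = y)
    (h : ∀ x, ∀ ε : ℝ, 0 < ε → ∀ᶠ y in 𝓝 x, d.edist y x ≤ ENNReal.ofReal ε) :
    d.toUniformSpace.toTopologicalSpace = t := by
  have hcont : @Continuous X X t d.toUniformSpace.toTopologicalSpace id := by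
    refine (@continuous_iff_continuousAt _ _ t (_) id).2 fun x =>
      (@Metric.nhds_basis_eball _ d x).tendsto_right_iff.2 fun δ hδ => ?_
    obtain ⟨ε, hε, hεδ⟩ := ENNReal.lt_iff_exists_nnreal_btwn.1 hδ
    filter_upwards [h x ε (NNReal.coe_pos.2 (ENNReal.coe_pos.1 hε))] with y hy
    exact (hy.trans_eq ENNReal.ofReal_coe_nnreal).trans_lt hεδ
  have hsymm := @Homeomorph.continuous_symm X X t d.toUniformSpace.toTopologicalSpace
    (@Continuous.homeoOfEquivCompactToT2 X X t d.toUniformSpace.toTopologicalSpace _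
      (t2Space_of_edist_eq_zero d h0) (Equiv.refl X) hcont)
  exact le_antisymm (continuous_id_iff_le.1 hsymm) (continuous_id_iff_le.1 hcont)

section MongeKantorovich

variable {A : Type u} [CStarAlgebra A] {L : selfAdjoint A → ℝ≥0∞}

namespace State

lemma ext_of_selfAdjoint {φ ψ : State A}
    (h : ∀ a : selfAdjoint A, φ.1 (a : A) = ψ.1 (a : A)) : φ = ψ := by
  refine Subtype.ext (ContinuousLinearMap.ext fun a => ?_)
  change φ.1 a = ψ.1 a
  rw [← realPart_add_I_smul_imaginaryPart a, map_add, map_add, map_smul, map_smul, h, h]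

lemma norm_apply_sub_apply_le (φ ψ : State A) (a b : selfAdjoint A) :
    ‖φ.1 (a : A) - ψ.1 (a : A)‖ ≤ 2 * ‖a - b‖ + ‖φ.1 (b : A) - ψ.1 (b : A)‖ := by
  have hle (χ : State A) : ‖χ.1 (a : A) - χ.1 (b : A)‖ ≤ ‖a - b‖ := by
    rw [← map_sub]
    exact χ.norm_apply_le (a - b).2
  calc ‖φ.1 (a : A) - ψ.1 (a : A)‖
      = ‖(φ.1 (a : A) - φ.1 (b : A)) - (ψ.1 (a : A) - ψ.1 (b : A))
          + (φ.1 (b : A) - ψ.1 (b : A))‖ := by congr 1; ring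
    _ ≤ (‖a - b‖ + ‖a - b‖) + ‖φ.1 (b : A) - ψ.1 (b : A)‖ :=
        norm_add_le_of_le (norm_sub_le_of_le (hle φ) (hle ψ)) le_rfl
    _ = _ := by ring

lemma apply_sub_apply_smul_one_add (φ ψ : State A) (r : ℝ) (a : selfAdjoint A) :
    φ.1 ((r • 1 + a : selfAdjoint A) : A) - ψ.1 ((r • 1 + a : selfAdjoint A) : A) =
      φ.1 (a : A) - ψ.1 (a : A) := by
  have hadd (χ : State A) : χ.1 ((r • 1 + a : selfAdjoint A) : A) = r + χ.1 (a : A) := by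
    rw [← χ.map_smul_one, ← map_add]
    rfl
  rw [hadd, hadd, add_sub_add_left_eq_sub]

lemma continuous_apply (a : A) : Continuous fun φ : State A => φ.1 a :=
  (WeakDual.eval_continuous a).comp continuous_subtype_val

/-- The function on the state space given by evaluation at a self-adjoint element. -/
def evaluation (a : selfAdjoint A) : BoundedContinuousFunction (State A) ℂ :=
  .mkOfCompact ⟨fun φ => φ.1 (a : A), continuous_apply (a : A)⟩

lemma isometry_evaluation [Nontrivial A] : Isometry (evaluation (A := A)) := by
  have happly (a b : selfAdjoint A) (φ : State A) :
      dist (evaluation a φ) (evaluation b φ) = ‖φ.1 ((a - b : selfAdjoint A) : A)‖ := by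
    rw [dist_eq_norm, AddSubgroup.coe_sub, map_sub]
    rfl
  refine Isometry.of_dist_eq fun a b => le_antisymm ?_ ?_
  · refine (BoundedContinuousFunction.dist_le dist_nonneg).2 fun φ => ?_
    rw [happly, dist_eq_norm]
    exact φ.norm_apply_le (a - b).2
  · obtain ⟨φ, hφ⟩ := exists_norm_apply_eq (a - b).2
    calc dist a b = dist (evaluation a φ) (evaluation b φ) := by
          rw [happly, hφ, dist_eq_norm]; rfl
      _ ≤ dist (evaluation a) (evaluation b) := BoundedContinuousFunction.dist_coe_le_dist φ

end State

lemma ofReal_norm_sub_le_mkDist (φ ψ : State A) {a : selfAdjoint A} (ha : L a ≤ 1) :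
    ENNReal.ofReal ‖φ.1 (a : A) - ψ.1 (a : A)‖ ≤ mkDist L φ ψ :=
  le_iSup₂ (f := fun (a : selfAdjoint A) (_ : L a ≤ 1) =>
    ENNReal.ofReal ‖φ.1 (a : A) - ψ.1 (a : A)‖) a ha

lemma mkDist_le_ofReal {φ ψ : State A} {r : ℝ}
    (h : ∀ a, L a ≤ 1 → ‖φ.1 (a : A) - ψ.1 (a : A)‖ ≤ r) : mkDist L φ ψ ≤ ENNReal.ofReal r :=
  iSup₂_le fun a ha => ENNReal.ofReal_le_ofReal (h a ha)

/-- The unit ball of `L` is totally bounded modulo the scalars. -/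
def HasTotallyBoundedBall (L : selfAdjoint A → ℝ≥0∞) : Prop :=
  ∃ E : Set (selfAdjoint A), TotallyBounded E ∧
    ∀ a, L a ≤ 1 → ∃ r : ℝ, ∃ e ∈ E, a = r • 1 + e

/-- Arzelà–Ascoli, applied to the elements as functions on the state space. -/
lemma totallyBounded_setOf_lip_le_one_and_apply_eq_zero [Nontrivial A]
    (hfin : ∀ φ ψ : State A, mkDist L φ ψ < ∞)
    (htop : (mkMetric L).toUniformSpace.toTopologicalSpace =
      (instTopologicalSpaceSubtype : TopologicalSpace (State A))) (μ : State A) :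
    TotallyBounded {a : selfAdjoint A | L a ≤ 1 ∧ μ.1 (a : A) = 0} := by
  set E := {a : selfAdjoint A | L a ≤ 1 ∧ μ.1 (a : A) = 0}
  have hcont : Continuous fun φ : State A => mkDist L φ μ :=
    continuous_edist_of_topology_eq (mkMetric L) htop μ
  obtain ⟨φ₀, -, hφ₀⟩ := isCompact_univ.exists_isMaxOn ⟨μ, trivial⟩ hcont.continuousOn
  refine (totallyBounded_image_iff State.isometry_evaluation.isUniformInducing).1 <|
    (BoundedContinuousFunction.arzela_ascoli _
      (isCompact_closedBall (0 : ℂ) (mkDist L φ₀ μ).toReal) _ ?_ fun φ => ?_).totallyBounded.subset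
        subset_closure
  · rintro _ φ ⟨a, ⟨ha, ha0⟩, rfl⟩
    have hle := (ofReal_norm_sub_le_mkDist φ μ ha).trans (hφ₀ (Set.mem_univ φ))
    rw [ha0, sub_zero, ENNReal.ofReal_le_iff_le_toReal (hfin _ _).ne] at hle
    exact mem_closedBall_zero_iff.2 hle
  · refine Metric.equicontinuousAt_iff_right.2 fun ε hε => ?_
    have hball : ∀ᶠ ψ in 𝓝 φ, mkDist L ψ φ < ENNReal.ofReal ε :=
      ((continuous_edist_of_topology_eq (mkMetric L) htop φ).tendsto φ).eventually_lt_const <| by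
        simpa [(mkMetric L).edist_self] using hε
    filter_upwards [hball] with ψ hψ
    rintro ⟨_, a, ⟨ha, -⟩, rfl⟩
    rw [dist_comm, dist_eq_norm]
    exact (ENNReal.ofReal_lt_ofReal_iff hε).1 ((ofReal_norm_sub_le_mkDist ψ φ ha).trans_lt hψ)

lemma HasTotallyBoundedBall.of_mkDist (hadd : ∀ a b, L (a + b) ≤ L a + L b)
    (hone : ∀ r : ℝ, L (r • 1) = 0) (hfin : ∀ φ ψ : State A, mkDist L φ ψ < ∞)
    (htop : (mkMetric L).toUniformSpace.toTopologicalSpace =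
      (instTopologicalSpaceSubtype : TopologicalSpace (State A))) :
    HasTotallyBoundedBall L := by
  rcases subsingleton_or_nontrivial A with _ | _
  · exact ⟨Set.univ, Set.subsingleton_univ.finite.totallyBounded, fun a _ =>
      ⟨0, a, trivial, Subsingleton.elim _ _⟩⟩
  obtain ⟨μ⟩ : Nonempty (State A) := inferInstance
  refine ⟨_, totallyBounded_setOf_lip_le_one_and_apply_eq_zero hfin htop μ, fun a ha =>
    ⟨(μ.1 (a : A)).re, -(μ.1 (a : A)).re • 1 + a, ⟨?_, ?_⟩, by simp⟩⟩
  · exact (hadd _ _).trans (by rw [hone, zero_add]; exact ha)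
  · calc μ.1 ((-(μ.1 (a : A)).re • 1 + a : selfAdjoint A) : A)
        = μ.1 ((-(μ.1 (a : A)).re) • (1 : A)) + μ.1 (a : A) := map_add μ.1 _ _
      _ = 0 := by
        rw [μ.map_smul_one, Complex.ofReal_neg, μ.coe_re_apply a.2, neg_add_cancel]

namespace HasTotallyBoundedBall

lemma mkDist_lt_top (hL : HasTotallyBoundedBall L) (φ ψ : State A) : mkDist L φ ψ < ∞ := by
  obtain ⟨E, hE, hLE⟩ := hL
  obtain ⟨M, hM⟩ := isBounded_iff_forall_norm_le.1 hE.isBounded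
  refine (mkDist_le_ofReal (r := M + M) fun a ha => ?_).trans_lt ENNReal.ofReal_lt_top
  obtain ⟨r, e, he, rfl⟩ := hLE a ha
  rw [State.apply_sub_apply_smul_one_add]
  exact norm_sub_le_of_le ((φ.norm_apply_le e.2).trans (hM e he))
    ((ψ.norm_apply_le e.2).trans (hM e he))

lemma eventually_mkDist_le (hL : HasTotallyBoundedBall L) (φ : State A) {ε : ℝ} (hε : 0 < ε) :
    ∀ᶠ ψ in 𝓝 φ, mkDist L ψ φ ≤ ENNReal.ofReal ε := by
  obtain ⟨E, hE, hLE⟩ := hL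
  obtain ⟨t, ht, hEt⟩ := Metric.totallyBounded_iff.1 hE (ε / 3) (by positivity)
  have hnet : ∀ᶠ ψ : State A in 𝓝 φ, ∀ c ∈ t, ‖ψ.1 (c : A) - φ.1 (c : A)‖ < ε / 3 := by
    refine (eventually_all_finite ht).2 fun c _ => ?_
    simpa [dist_eq_norm] using
      Metric.tendsto_nhds.1 ((State.continuous_apply (c : A)).tendsto φ) (ε / 3) (by positivity)
  filter_upwards [hnet] with ψ hψ
  refine mkDist_le_ofReal fun a ha => ?_
  obtain ⟨r, e, he, rfl⟩ := hLE a ha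
  obtain ⟨c, hc, hec⟩ : ∃ c ∈ t, dist e c < ε / 3 := by simpa using hEt he
  rw [dist_eq_norm] at hec
  rw [State.apply_sub_apply_smul_one_add]
  linarith [State.norm_apply_sub_apply_le ψ φ e c, hψ c hc]

end HasTotallyBoundedBall

lemma eq_of_mkDist_eq_zero (hsmul : ∀ (r : ℝ) a, L (r • a) = ENNReal.ofReal |r| * L a)
    (hdense : Dense {a | L a < ∞}) {φ ψ : State A} (h : mkDist L φ ψ = 0) : φ = ψ := by
  have hcont (χ : State A) : Continuous fun a : selfAdjoint A => χ.1 (a : A) :=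
    (WeakDual.toStrongDual χ.1).continuous.comp continuous_subtype_val
  refine State.ext_of_selfAdjoint <| congrFun <|
    (hcont φ).ext_on hdense (hcont ψ) fun a (ha : L a < ∞) => ?_
  set l : ℝ := (L a).toReal + 1
  have hl0 : 0 < l := by positivity
  have hball : L (l⁻¹ • a) ≤ 1 := by
    rw [hsmul, ← ENNReal.ofReal_toReal ha.ne, ← ENNReal.ofReal_mul (abs_nonneg _),
      ENNReal.ofReal_le_one, abs_of_pos (inv_pos.2 hl0), inv_mul_le_one₀ hl0]
    linarith
  have hzero := (ofReal_norm_sub_le_mkDist φ ψ hball).trans_eq h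
  rw [ENNReal.ofReal_le_iff_le_toReal ENNReal.zero_ne_top, ENNReal.toReal_zero, norm_le_zero_iff,
    selfAdjoint.val_smul, ← Complex.coe_smul, map_smul, map_smul, ← smul_sub, smul_eq_zero] at hzero
  exact sub_eq_zero.1 (hzero.resolve_left (by simpa using hl0.ne'))

lemma HasTotallyBoundedBall.mkMetric_topology (hL : HasTotallyBoundedBall L)
    (hsmul : ∀ (r : ℝ) a, L (r • a) = ENNReal.ofReal |r| * L a) (hdense : Dense {a | L a < ∞}) :
    (mkMetric L).toUniformSpace.toTopologicalSpace =
      (instTopologicalSpaceSubtype : TopologicalSpace (State A)) :=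
  topology_eq_of_eventually_edist_le (mkMetric L)
    (fun _ _ h => eq_of_mkDist_eq_zero hsmul hdense h) fun φ _ hε => hL.eventually_mkDist_le φ hε

end MongeKantorovich

section LipNorms

variable {A : Type u} [CStarAlgebra A] {L : selfAdjoint A → ℝ≥0∞}

/-- The requirements on the seminorm of a quantum compact metric space that do not involve the
product; the condition on the Monge–Kantorovich metric is replaced by Rieffel's criterion. -/
structure IsLipNorm (L : selfAdjoint A → ℝ≥0∞) : Prop where
  map_add_le : ∀ a b, L (a + b) ≤ L a + L b
  map_smul : ∀ (r : ℝ) a, L (r • a) = ENNReal.ofReal |r| * L a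
  dense_domain : Dense {a | L a < ∞}
  eq_zero_iff : ∀ a, L a = 0 ↔ ∃ r : ℝ, a = r • 1
  isClosed_ball : IsClosed {a | L a ≤ 1}
  hasTotallyBoundedBall : HasTotallyBoundedBall L

namespace IsLipNorm

lemma map_smul_one (hL : IsLipNorm L) (r : ℝ) : L (r • 1) = 0 := (hL.eq_zero_iff _).2 ⟨r, rfl⟩

lemma map_zero (hL : IsLipNorm L) : L 0 = 0 := by simpa using hL.map_smul_one 0

lemma exists_totallyBounded (hL : IsLipNorm L) :
    ∃ E : Set (selfAdjoint A), TotallyBounded E ∧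
      ∀ (a : selfAdjoint A) (l : ℝ≥0), L a ≤ l → ∃ r : ℝ, ∃ e ∈ E, a = r • 1 + (l : ℝ) • e := by
  obtain ⟨E, hE, hLE⟩ := hL.hasTotallyBoundedBall
  refine ⟨E, hE, fun a l hl => ?_⟩
  rcases eq_or_ne l 0 with rfl | hl0
  · obtain ⟨-, e, he, -⟩ := hLE 0 (by simp [hL.map_zero])
    obtain ⟨r, rfl⟩ := (hL.eq_zero_iff a).1 (by simpa using hl)
    exact ⟨r, e, he, by simp⟩
  · have hball : L ((l : ℝ)⁻¹ • a) ≤ 1 := by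
      rw [hL.map_smul, abs_of_nonneg (by positivity), ← NNReal.coe_inv, ENNReal.ofReal_coe_nnreal,
        ENNReal.coe_inv hl0]
      exact (mul_le_mul_right hl _).trans (ENNReal.inv_mul_le_one _)
    obtain ⟨r, e, he, hae⟩ := hLE _ hball
    refine ⟨l * r, e, he, ?_⟩
    rw [mul_smul, ← smul_add, ← hae, smul_inv_smul₀ (by positivity)]

end IsLipNorm

/-- The Leibniz inequality governed by `F` for the binary operation `op`. -/
def SatisfiesLeibniz (F : ℝ≥0 → ℝ≥0 → ℝ≥0 → ℝ≥0 → ℝ≥0) (L : selfAdjoint A → ℝ≥0∞)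
    (op : selfAdjoint A → selfAdjoint A → selfAdjoint A) : Prop :=
  ∀ a b (l m : ℝ≥0), L a ≤ l → L b ≤ m → L (op a b) ≤ F ‖a‖₊ ‖b‖₊ l m

lemma SatisfiesLeibniz.mono {F G : ℝ≥0 → ℝ≥0 → ℝ≥0 → ℝ≥0 → ℝ≥0}
    {op : selfAdjoint A → selfAdjoint A → selfAdjoint A} (h : SatisfiesLeibniz F L op)
    (hFG : F ≤ G) : SatisfiesLeibniz G L op := fun a b l m ha hb =>
  (h a b l m ha hb).trans (ENNReal.coe_le_coe.2 (hFG _ _ _ _))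

lemma IsPermissible.satisfiesLeibniz_iff {F : ℝ≥0 → ℝ≥0 → ℝ≥0 → ℝ≥0 → ℝ≥0} (hF : IsPermissible F)
    {op : selfAdjoint A → selfAdjoint A → selfAdjoint A} :
    SatisfiesLeibniz F L op ↔ ∀ a b, L a < ∞ → L b < ∞ →
      L (op a b) ≤ F ‖a‖₊ ‖b‖₊ (L a).toNNReal (L b).toNNReal := by
  refine ⟨fun h a b ha hb => h a b _ _ (ENNReal.coe_toNNReal ha.ne).ge
    (ENNReal.coe_toNNReal hb.ne).ge, fun h a b l m ha hb => ?_⟩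
  refine (h a b (ha.trans_lt ENNReal.coe_lt_top) (hb.trans_lt ENNReal.coe_lt_top)).trans
    (ENNReal.coe_le_coe.2 (hF.mono le_rfl le_rfl ?_ ?_))
  · exact ENNReal.toNNReal_mono ENNReal.coe_ne_top ha
  · exact ENNReal.toNNReal_mono ENNReal.coe_ne_top hb

end LipNorms

lemma isQuasiLeibnizQCMS_iff {F : ℝ≥0 → ℝ≥0 → ℝ≥0 → ℝ≥0 → ℝ≥0} {X : CStarPair.{u}} :
    IsQuasiLeibnizQCMS F X ↔ IsPermissible F ∧ IsLipNorm X.lip ∧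
      ∀ c ∈ jordanLieCoeffs, SatisfiesLeibniz F X.lip (saHermProd c) := by
  refine ⟨fun h => ⟨h.permissible, ?_, ?_⟩, fun ⟨hF, hL, hop⟩ => ?_⟩
  · exact
      { map_add_le := h.lip_add
        map_smul := h.lip_smul
        dense_domain := h.dense_domain
        eq_zero_iff := h.lip_eq_zero
        isClosed_ball := h.closed_ball
        hasTotallyBoundedBall := .of_mkDist h.lip_add
          (fun r => (h.lip_eq_zero _).2 ⟨r, rfl⟩) h.mk_finite h.mk_topology }
  · exact forall_jordanLieCoeffs_saHermProd.2 ⟨h.permissible.satisfiesLeibniz_iff.2 h.lip_jordan,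
      h.permissible.satisfiesLeibniz_iff.2 h.lip_lie⟩
  · obtain ⟨hJ, hLie⟩ := forall_jordanLieCoeffs_saHermProd.1 hop
    exact
      { permissible := hF
        lip_add := hL.map_add_le
        lip_smul := hL.map_smul
        dense_domain := hL.dense_domain
        lip_eq_zero := hL.eq_zero_iff
        closed_ball := hL.isClosed_ball
        mk_finite := hL.hasTotallyBoundedBall.mkDist_lt_top
        mk_topology := hL.hasTotallyBoundedBall.mkMetric_topology hL.map_smul hL.dense_domain
        lip_jordan := hF.satisfiesLeibniz_iff.1 hJ
        lip_lie := hF.satisfiesLeibniz_iff.1 hLie }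

lemma isPermissible_cdFun {C : ℝ≥0} (hC : 1 ≤ C) (D : ℝ≥0) : IsPermissible (cdFun C D) where
  mono x x' y y' lx lx' ly ly' hx hy hlx hly := by unfold cdFun; gcongr
  leibniz_le x y lx ly := (le_mul_of_one_le_left zero_le hC).trans le_self_add

lemma cdFun_mono {C C' D D' : ℝ≥0} (hC : C ≤ C') (hD : D ≤ D') : cdFun C D ≤ cdFun C' D' :=
  fun x y lx ly => by unfold cdFun; gcongr

lemma leibnizFun_eq_cdFun : leibnizFun = cdFun 1 0 := by
  funext x y lx ly; simp [leibnizFun, cdFun]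

lemma IsQuasiLeibnizQCMS.mono {F G : ℝ≥0 → ℝ≥0 → ℝ≥0 → ℝ≥0 → ℝ≥0} {X : CStarPair.{u}}
    (h : IsQuasiLeibnizQCMS F X) (hG : IsPermissible G) (hFG : F ≤ G) :
    IsQuasiLeibnizQCMS G X :=
  have ⟨_, hL, hop⟩ := isQuasiLeibnizQCMS_iff.1 h
  isQuasiLeibnizQCMS_iff.2 ⟨hG, hL, fun c hc => (hop c hc).mono hFG⟩

/-! ### The tunnel of an approximate factorization -/

lemma totallyBounded_prod {α β : Type*} [UniformSpace α] [UniformSpace β] {s : Set α} {t : Set β}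
    (hs : TotallyBounded s) (ht : TotallyBounded t) : TotallyBounded (s ×ˢ t) := by
  refine totallyBounded_iff_ultrafilter.2 fun f hf => ?_
  have hfst : Cauchy (f.map Prod.fst : Filter α) :=
    totallyBounded_iff_ultrafilter.1 hs (f.map _) <| tendsto_principal.2 <|
      mem_of_superset (le_principal_iff.1 hf) fun _ hp => hp.1
  have hsnd : Cauchy (f.map Prod.snd : Filter β) :=
    totallyBounded_iff_ultrafilter.1 ht (f.map _) <| tendsto_principal.2 <|
      mem_of_superset (le_principal_iff.1 hf) fun _ hp => hp.2
  exact (hfst.prod hsnd).mono (le_prod.2 ⟨le_rfl, le_rfl⟩)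

section SelfAdjointProd

variable {A B : Type u} [CStarAlgebra A] [CStarAlgebra B]

/-- The first component of a self-adjoint element of a product. -/
def saFst : selfAdjoint (A × B) →L[ℝ] selfAdjoint A where
  toFun d := ⟨d.1.1, congrArg Prod.fst d.2⟩
  map_add' _ _ := rfl
  map_smul' _ _ := rfl
  cont := (continuous_fst.comp continuous_subtype_val).subtype_mk _

/-- The second component of a self-adjoint element of a product. -/
def saSnd : selfAdjoint (A × B) →L[ℝ] selfAdjoint B where
  toFun d := ⟨d.1.2, congrArg Prod.snd d.2⟩
  map_add' _ _ := rfl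
  map_smul' _ _ := rfl
  cont := (continuous_snd.comp continuous_subtype_val).subtype_mk _

/-- The self-adjoint element of a product with given components. -/
def saPair (a : selfAdjoint A) (b : selfAdjoint B) : selfAdjoint (A × B) :=
  ⟨(a, b), Prod.ext a.2 b.2⟩

@[simp] lemma saFst_saPair (a : selfAdjoint A) (b : selfAdjoint B) : saFst (saPair a b) = a := rfl

@[simp] lemma saSnd_saPair (a : selfAdjoint A) (b : selfAdjoint B) : saSnd (saPair a b) = b := rfl

lemma saPair_saFst_saSnd (d : selfAdjoint (A × B)) : saPair (saFst d) (saSnd d) = d := rfl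

lemma norm_selfAdjoint_prod (d : selfAdjoint (A × B)) : ‖d‖ = max ‖saFst d‖ ‖saSnd d‖ := rfl

lemma isometry_saPair : Isometry fun p : selfAdjoint A × selfAdjoint B => saPair p.1 p.2 :=
  Isometry.of_dist_eq fun _ _ => rfl

end SelfAdjointProd

section TunnelSeminorm

variable {A B : Type u} [CStarAlgebra A] [CStarAlgebra B] {L : selfAdjoint A → ℝ≥0∞}
  {ψ : A →ₗ[ℂ] B} {δ : ℝ≥0}

/-- The seminorm `max (L a) (δ⁻¹ ‖ψ a - b‖)` on the self-adjoint part of `A × B`, which declares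
`a` and `b` to be close when `b` is almost `ψ a`. -/
def tunnelLip (L : selfAdjoint A → ℝ≥0∞) (ψ : A →ₗ[ℂ] B) (δ : ℝ≥0) (d : selfAdjoint (A × B)) :
    ℝ≥0∞ :=
  max (L (saFst d)) (‖ψ (saFst d : A) - saSnd d‖ₑ / δ)

lemma tunnelLip_le_iff (hδ : 0 < δ) {d : selfAdjoint (A × B)} {l : ℝ≥0} :
    tunnelLip L ψ δ d ≤ l ↔ L (saFst d) ≤ l ∧ ‖ψ (saFst d : A) - saSnd d‖ ≤ δ * l := by
  rw [tunnelLip, max_le_iff, ENNReal.div_le_iff' (by simpa using hδ.ne') ENNReal.coe_ne_top,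
    enorm_eq_nnnorm, ← ENNReal.coe_mul, ENNReal.coe_le_coe, ← NNReal.coe_le_coe, coe_nnnorm,
    NNReal.coe_mul]

lemma tunnelLip_lt_top_iff (hδ : 0 < δ) {d : selfAdjoint (A × B)} :
    tunnelLip L ψ δ d < ∞ ↔ L (saFst d) < ∞ := by
  have hlt : ‖ψ (saFst d : A) - saSnd d‖ₑ / δ < ∞ :=
    ENNReal.div_lt_top enorm_ne_top (by simpa using hδ.ne')
  rw [tunnelLip, max_lt_iff, and_iff_left hlt]

lemma tunnelLip_add_le (hL : ∀ a b, L (a + b) ≤ L a + L b) (d e : selfAdjoint (A × B)) :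
    tunnelLip L ψ δ (d + e) ≤ tunnelLip L ψ δ d + tunnelLip L ψ δ e := by
  refine max_le ((hL _ _).trans (add_le_add (le_max_left _ _) (le_max_left _ _)))
    (le_trans ?_ (add_le_add (le_max_right _ _) (le_max_right _ _)))
  rw [← ENNReal.add_div, map_add, map_add, AddSubgroup.coe_add, AddSubgroup.coe_add, map_add,
    add_sub_add_comm]
  gcongr
  exact enorm_add_le _ _

lemma tunnelLip_smul (hL : ∀ (r : ℝ) a, L (r • a) = ENNReal.ofReal |r| * L a) (r : ℝ)
    (d : selfAdjoint (A × B)) :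
    tunnelLip L ψ δ (r • d) = ENNReal.ofReal |r| * tunnelLip L ψ δ d := by
  rw [tunnelLip, tunnelLip, map_smul, map_smul, hL, selfAdjoint.val_smul, selfAdjoint.val_smul,
    LinearMap.map_smul_of_tower, ← smul_sub, enorm_smul, Real.enorm_eq_ofReal_abs, mul_div_assoc,
    mul_max]

lemma isClosed_tunnelLip_le_one (hδ : 0 < δ) (hψ : Continuous ψ) (hL : IsClosed {a | L a ≤ 1}) :
    IsClosed {d : selfAdjoint (A × B) | tunnelLip L ψ δ d ≤ 1} := by
  have hball : {d : selfAdjoint (A × B) | tunnelLip L ψ δ d ≤ 1} =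
      saFst ⁻¹' {a | L a ≤ 1} ∩
        {d : selfAdjoint (A × B) | ‖ψ (saFst d : A) - (saSnd d : B)‖ ≤ δ} := by
    ext d
    simpa using tunnelLip_le_iff (L := L) (ψ := ψ) hδ (d := d) (l := 1)
  rw [hball]
  refine (hL.preimage saFst.continuous).inter (isClosed_le ?_ continuous_const)
  exact ((hψ.comp (continuous_subtype_val.comp (saFst (A := A) (B := B)).continuous)).sub
    (continuous_subtype_val.comp (saSnd (A := A) (B := B)).continuous)).norm

lemma dense_tunnelLip_lt_top (hδ : 0 < δ) (hL : Dense {a | L a < ∞}) :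
    Dense {d : selfAdjoint (A × B) | tunnelLip L ψ δ d < ∞} := by
  have hset : {d : selfAdjoint (A × B) | tunnelLip L ψ δ d < ∞} =
      (fun p : selfAdjoint A × selfAdjoint B => saPair p.1 p.2) ''
        ({a | L a < ∞} ×ˢ Set.univ) := by
    ext d
    rw [Set.mem_ofPred_eq, tunnelLip_lt_top_iff hδ]
    exact ⟨fun h => ⟨(saFst d, saSnd d), ⟨h, trivial⟩, rfl⟩, by rintro ⟨p, ⟨hp, -⟩, rfl⟩; exact hp⟩
  rw [hset]
  exact Function.Surjective.denseRange (fun d => ⟨(saFst d, saSnd d), rfl⟩) |>.dense_image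
    isometry_saPair.continuous (hL.prod dense_univ)

lemma tunnelLip_eq_zero_iff (hδ : 0 < δ) (hψ : IsUnitalPositiveMap ψ)
    (hL : ∀ a, L a = 0 ↔ ∃ r : ℝ, a = r • 1) (d : selfAdjoint (A × B)) :
    tunnelLip L ψ δ d = 0 ↔ ∃ r : ℝ, d = r • 1 := by
  have hzero := tunnelLip_le_iff (L := L) (ψ := ψ) hδ (d := d) (l := 0)
  simp only [ENNReal.coe_zero, nonpos_iff_eq_zero, NNReal.coe_zero, mul_zero, norm_le_zero_iff,
    sub_eq_zero, hL] at hzero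
  have hsmul (r : ℝ) : ψ ((r • 1 : selfAdjoint A) : A) = (r • 1 : selfAdjoint B) :=
    hψ.map_smul_one r
  rw [hzero]
  constructor
  · rintro ⟨⟨r, hr⟩, hsnd⟩
    rw [hr, hsmul, SetLike.coe_eq_coe] at hsnd
    exact ⟨r, by rw [← saPair_saFst_saSnd d, hr, ← hsnd]; rfl⟩
  · rintro ⟨r, rfl⟩
    exact ⟨⟨r, rfl⟩, hsmul r⟩

lemma totallyBounded_closedBall_selfAdjoint [FiniteDimensional ℂ B] (R : ℝ) :
    TotallyBounded (Metric.closedBall (0 : selfAdjoint B) R) := by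
  have : ProperSpace B := FiniteDimensional.proper ℂ B
  exact totallyBounded_preimage (f := ((↑) : selfAdjoint B → B))
    isUniformEmbedding_subtype_val.isUniformInducing (isCompact_closedBall 0 R).totallyBounded

lemma HasTotallyBoundedBall.tunnelLip [FiniteDimensional ℂ B] (hL : HasTotallyBoundedBall L)
    (hψ : IsUnitalPositiveMap ψ) (hδ : 0 < δ) : HasTotallyBoundedBall (tunnelLip L ψ δ) := by
  obtain ⟨E, hE, hLE⟩ := hL
  obtain ⟨M, hM⟩ := isBounded_iff_forall_norm_le.1 hE.isBounded
  refine ⟨(fun p : selfAdjoint A × selfAdjoint B => saPair p.1 p.2) ''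
    (E ×ˢ Metric.closedBall 0 (M + δ)),
    (totallyBounded_prod hE (totallyBounded_closedBall_selfAdjoint _)).image
      isometry_saPair.uniformContinuous, fun d hd => ?_⟩
  obtain ⟨hfst, hsnd⟩ := (tunnelLip_le_iff (l := 1) hδ).1 (by simpa using hd)
  obtain ⟨r, e, he, hre⟩ := hLE (saFst d) (by simpa using hfst)
  refine ⟨r, saPair e (saSnd d - r • 1), ⟨(e, saSnd d - r • 1), ⟨he, ?_⟩, rfl⟩, ?_⟩
  · have hdiff : ((saSnd d - r • 1 : selfAdjoint B) : B) =
        ψ (e : A) - (ψ (saFst d : A) - saSnd d) := by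
      rw [hre, AddSubgroup.coe_add, map_add, selfAdjoint.val_smul, selfAdjoint.val_one,
        hψ.map_smul_one, AddSubgroup.coe_sub, selfAdjoint.val_smul, selfAdjoint.val_one]
      abel
    rw [mem_closedBall_zero_iff]
    change ‖((saSnd d - r • 1 : selfAdjoint B) : B)‖ ≤ _
    rw [hdiff]
    exact norm_sub_le_of_le ((hψ.norm_map_le e.2).trans (hM e he)) (by simpa using hsnd)
  · rw [← saPair_saFst_saSnd d, hre]
    refine Subtype.ext (Prod.ext rfl ?_)
    exact (add_sub_cancel (r • (1 : B)) _).symm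

lemma IsLipNorm.tunnelLip [FiniteDimensional ℂ B] (hL : IsLipNorm L)
    (hψ : IsUnitalPositiveMap ψ) (hδ : 0 < δ) : IsLipNorm (tunnelLip L ψ δ) where
  map_add_le := tunnelLip_add_le hL.map_add_le
  map_smul := tunnelLip_smul hL.map_smul
  dense_domain := dense_tunnelLip_lt_top hδ hL.dense_domain
  eq_zero_iff := tunnelLip_eq_zero_iff hδ hψ hL.eq_zero_iff
  isClosed_ball := isClosed_tunnelLip_le_one hδ hψ.isPositiveMap.continuous hL.isClosed_ball
  hasTotallyBoundedBall := hL.hasTotallyBoundedBall.tunnelLip hψ hδ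

end TunnelSeminorm

section QuotientSeminorm

open scoped Pointwise

variable {A B : Type u} [CStarAlgebra A] [CStarAlgebra B] {L : selfAdjoint A → ℝ≥0∞}
  {π : selfAdjoint A →L[ℝ] selfAdjoint B}

lemma IsLipNorm.exists_isCompact (hL : IsLipNorm L) :
    ∃ K : Set (selfAdjoint A), IsCompact K ∧
      {a | L a ≤ 1} = (ℝ ∙ (1 : selfAdjoint A) : Set (selfAdjoint A)) + K := by
  obtain ⟨E, hE, hLE⟩ := hL.hasTotallyBoundedBall
  have hshift (r : ℝ) (a : selfAdjoint A) : L (r • 1 + a) ≤ L a := by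
    simpa [hL.map_smul_one] using hL.map_add_le (r • 1) a
  have : CompleteSpace (selfAdjoint A) :=
    (isClosed_eq continuous_star continuous_id : IsClosed {a : A | star a = a}).completeSpace_coe
  refine ⟨closure E ∩ {a | L a ≤ 1}, (hE.closure.isCompact_of_isClosed isClosed_closure).inter_right
    hL.isClosed_ball, Set.Subset.antisymm (fun a ha => ?_) ?_⟩
  · obtain ⟨r, e, he, rfl⟩ := hLE a ha
    refine Set.add_mem_add (Submodule.mem_span_singleton.2 ⟨r, rfl⟩) ⟨subset_closure he, ?_⟩
    simpa using (hshift (-r) (r • 1 + e)).trans ha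
  · rintro _ ⟨c, hc, e, he, rfl⟩
    obtain ⟨r, rfl⟩ := Submodule.mem_span_singleton.1 hc
    exact (hshift r e).trans he.2

/-- The quotient of the seminorm `L` along `π`. -/
def quotientLip (L : selfAdjoint A → ℝ≥0∞) (π : selfAdjoint A →L[ℝ] selfAdjoint B)
    (b : selfAdjoint B) : ℝ≥0∞ :=
  ⨅ (a : selfAdjoint A) (_ : π a = b), L a

lemma quotientLip_map_le (a : selfAdjoint A) : quotientLip L π (π a) ≤ L a :=
  iInf₂_le_of_le a rfl le_rfl

lemma quotientLip_lt_iff {b : selfAdjoint B} {l : ℝ≥0∞} :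
    quotientLip L π b < l ↔ ∃ a, π a = b ∧ L a < l := by
  simp only [quotientLip, iInf_lt_iff, exists_prop]

lemma quotientLip_add_le (hL : ∀ a b, L (a + b) ≤ L a + L b) (b c : selfAdjoint B) :
    quotientLip L π (b + c) ≤ quotientLip L π b + quotientLip L π c := by
  refine ENNReal.le_iInf₂_add_iInf₂ fun a ha a' ha' => ?_
  rw [← ha, ← ha', ← map_add]
  exact (quotientLip_map_le _).trans (hL a a')

lemma quotientLip_smul (hL : ∀ (r : ℝ) a, L (r • a) = ENNReal.ofReal |r| * L a) (r : ℝ)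
    (b : selfAdjoint B) : quotientLip L π (r • b) = ENNReal.ofReal |r| * quotientLip L π b := by
  rcases eq_or_ne r 0 with rfl | hr
  · have hzero : L 0 = 0 := by simpa using hL 0 0
    simpa [hzero] using quotientLip_map_le (L := L) (π := π) 0
  · have habs : ENNReal.ofReal |r| ≠ 0 := by simpa using hr
    simp only [quotientLip, ENNReal.mul_iInf_of_ne habs ENNReal.ofReal_ne_top, ← hL]
    refine le_antisymm (le_iInf₂ fun a ha => iInf₂_le (r • a) (by rw [map_smul, ha]))
      (le_iInf₂ fun a ha => ?_)
    exact iInf₂_le_of_le (r⁻¹ • a) (by rw [map_smul, ha, inv_smul_smul₀ hr])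
      (by rw [smul_inv_smul₀ hr])

lemma isClosed_image_lip_le_one (hL : IsLipNorm L) : IsClosed (π '' {a | L a ≤ 1}) := by
  obtain ⟨K, hK, hball⟩ := hL.exists_isCompact
  have hline : (π '' (ℝ ∙ (1 : selfAdjoint A) : Set (selfAdjoint A))) =
      ((ℝ ∙ (1 : selfAdjoint A)).map (π : selfAdjoint A →ₗ[ℝ] selfAdjoint B) : Set _) := rfl
  rw [hball, Set.image_add, hline]
  exact (Submodule.closed_of_finiteDimensional _).add_right_of_isCompact (hK.image π.continuous)

lemma setOf_quotientLip_le_one (hL : IsLipNorm L) :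
    {b | quotientLip L π b ≤ 1} = π '' {a | L a ≤ 1} := by
  refine Set.Subset.antisymm (fun b hb => ?_) ?_
  · have hlim : Tendsto (fun t : ℝ => t • b) (𝓝[<] 1) (𝓝 b) :=
      ((continuous_id.smul continuous_const).tendsto' 1 b (one_smul ℝ b)).mono_left
        nhdsWithin_le_nhds
    refine (isClosed_image_lip_le_one hL).mem_of_tendsto hlim ?_
    filter_upwards [Ioo_mem_nhdsLT zero_lt_one] with t ht
    have hlt : quotientLip L π (t • b) < 1 := by
      rw [quotientLip_smul hL.map_smul]
      refine (mul_le_of_le_one_right' hb).trans_lt ?_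
      simpa [abs_of_pos ht.1] using ht.2
    obtain ⟨a, ha, hLa⟩ := quotientLip_lt_iff.1 hlt
    exact ⟨a, hLa.le, ha⟩
  · rintro _ ⟨a, ha, rfl⟩
    exact (quotientLip_map_le a).trans ha

lemma quotientLip_eq_zero_iff (hL : IsLipNorm L) (h1 : π 1 = 1) (b : selfAdjoint B) :
    quotientLip L π b = 0 ↔ ∃ r : ℝ, b = r • 1 := by
  constructor
  · intro hb
    obtain ⟨E, hE, hLE⟩ := hL.exists_totallyBounded
    obtain ⟨M, hM⟩ := isBounded_iff_forall_norm_le.1 (hE.image π.uniformContinuous).isBounded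
    have hclosure : b ∈ closure (ℝ ∙ (1 : selfAdjoint B) : Set (selfAdjoint B)) := by
      refine Metric.mem_closure_iff.2 fun ε hε => ?_
      obtain ⟨l, hl, hlM⟩ := exists_pos_mul_lt hε M
      lift l to ℝ≥0 using hl.le
      obtain ⟨a, rfl, ha⟩ := quotientLip_lt_iff.1 <|
        hb.trans_lt (ENNReal.coe_pos.2 (NNReal.coe_pos.1 hl))
      obtain ⟨r, e, he, rfl⟩ := hLE a l ha.le
      refine ⟨r • 1, Submodule.mem_span_singleton.2 ⟨r, rfl⟩, ?_⟩
      rw [dist_eq_norm, map_add, map_smul, map_smul, h1, add_sub_cancel_left, norm_smul,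
        NNReal.norm_eq, mul_comm]
      exact (mul_le_mul_of_nonneg_right (hM _ ⟨e, he, rfl⟩) l.2).trans_lt hlM
    rw [(Submodule.closed_of_finiteDimensional _).closure_eq] at hclosure
    obtain ⟨r, hr⟩ := Submodule.mem_span_singleton.1 hclosure
    exact ⟨r, hr.symm⟩
  · rintro ⟨r, rfl⟩
    rw [← h1, ← map_smul, ← nonpos_iff_eq_zero]
    exact (quotientLip_map_le _).trans_eq (hL.map_smul_one r)

lemma hasTotallyBoundedBall_quotientLip (hL : IsLipNorm L) (h1 : π 1 = 1) :
    HasTotallyBoundedBall (quotientLip L π) := by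
  obtain ⟨E, hE, hLE⟩ := hL.hasTotallyBoundedBall
  refine ⟨π '' E, hE.image π.uniformContinuous, fun b hb => ?_⟩
  obtain ⟨a, ha, rfl⟩ := (setOf_quotientLip_le_one hL).subset hb
  obtain ⟨r, e, he, rfl⟩ := hLE a ha
  exact ⟨r, π e, ⟨e, he, rfl⟩, by rw [map_add, map_smul, h1]⟩

lemma IsLipNorm.quotientLip (hL : IsLipNorm L) (hπ : Function.Surjective π) (h1 : π 1 = 1) :
    IsLipNorm (quotientLip L π) where
  map_add_le := quotientLip_add_le hL.map_add_le
  map_smul := quotientLip_smul hL.map_smul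
  dense_domain := (hπ.denseRange.dense_image π.continuous hL.dense_domain).mono <|
    Set.image_subset_iff.2 fun a ha => (quotientLip_map_le a).trans_lt ha
  eq_zero_iff := quotientLip_eq_zero_iff hL h1
  isClosed_ball := by
    rw [setOf_quotientLip_le_one hL]
    exact isClosed_image_lip_le_one hL
  hasTotallyBoundedBall := hasTotallyBoundedBall_quotientLip hL h1

/-- If passing to the quotient decreases the norm by at most `k` times the seminorm, then the
Leibniz inequality survives with an additional term. -/
lemma SatisfiesLeibniz.quotientLip {C D k : ℝ≥0}
    {op : selfAdjoint A → selfAdjoint A → selfAdjoint A}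
    {op' : selfAdjoint B → selfAdjoint B → selfAdjoint B}
    (hL : SatisfiesLeibniz (cdFun C D) L op) (hop : ∀ a a', π (op a a') = op' (π a) (π a'))
    (hπ : ∀ (a : selfAdjoint A) (l : ℝ≥0), L a ≤ l → ‖a‖₊ ≤ ‖π a‖₊ + k * l) :
    SatisfiesLeibniz (cdFun C (D + 2 * C * k)) (quotientLip L π) op' := by
  intro b b' l m hl hm
  have hlt : ∀ l' m', l < l' → m < m' →
      QuantumMetric.quotientLip L π (op' b b') ≤ cdFun C (D + 2 * C * k) ‖b‖₊ ‖b'‖₊ l' m' := by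
    intro l' m' hl' hm'
    obtain ⟨a, rfl, ha⟩ := quotientLip_lt_iff.1 (hl.trans_lt (ENNReal.coe_lt_coe.2 hl'))
    obtain ⟨a', rfl, ha'⟩ := quotientLip_lt_iff.1 (hm.trans_lt (ENNReal.coe_lt_coe.2 hm'))
    rw [← hop]
    refine (quotientLip_map_le _).trans ((hL a a' l' m' ha.le ha'.le).trans
      (ENNReal.coe_le_coe.2 ?_))
    calc cdFun C D ‖a‖₊ ‖a'‖₊ l' m'
        ≤ C * ((‖π a‖₊ + k * l') * m' + (‖π a'‖₊ + k * m') * l') + D * l' * m' := by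
          unfold cdFun
          gcongr
          exacts [hπ a l' ha.le, hπ a' m' ha'.le]
      _ = cdFun C (D + 2 * C * k) ‖π a‖₊ ‖π a'‖₊ l' m' := by unfold cdFun; ring
  have hlim : Tendsto (fun t : ℝ≥0 =>
      (cdFun C (D + 2 * C * k) ‖b‖₊ ‖b'‖₊ (l + t) (m + t) : ℝ≥0∞)) (𝓝[>] 0)
      (𝓝 (cdFun C (D + 2 * C * k) ‖b‖₊ ‖b'‖₊ l m)) := by
    have hcont : Continuous fun t : ℝ≥0 => cdFun C (D + 2 * C * k) ‖b‖₊ ‖b'‖₊ (l + t) (m + t) := by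
      unfold cdFun; fun_prop
    exact ((ENNReal.continuous_coe.comp hcont).tendsto' 0 _ (by simp)).mono_left
      nhdsWithin_le_nhds
  refine ge_of_tendsto hlim ?_
  filter_upwards [self_mem_nhdsWithin] with t ht
  exact hlt _ _ (lt_add_of_pos_right l ht) (lt_add_of_pos_right m ht)

end QuotientSeminorm

section Extent

variable {A B C : Type u} [CStarAlgebra A] [CStarAlgebra B] [CStarAlgebra C]
  {L : selfAdjoint A → ℝ≥0∞}

lemma mkHausdorff_univ_le {s : Set (State A)} {r : ℝ≥0∞} (h : ∀ φ, ∃ ψ ∈ s, mkDist L φ ψ ≤ r) :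
    mkHausdorff L Set.univ s ≤ r :=
  @Metric.hausdorffEDist_le_of_mem_edist (State A) (mkMetric L) _ _ _ (fun φ _ => h φ)
    (fun φ _ => ⟨φ, Set.mem_univ _, by rw [@edist_self _ (mkMetric L)]; exact zero_le⟩)

lemma mkHausdorff_univ_range_pullback_le {π : A →⋆ₐ[ℂ] B} {f : B →ₗ[ℂ] A}
    (hf : IsUnitalPositiveMap f) {r : ℝ} (h : ∀ a, L a ≤ 1 → ‖(a : A) - f (π a)‖ ≤ r) :
    mkHausdorff L Set.univ (Set.range (State.pullback π)) ≤ ENNReal.ofReal r := by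
  refine mkHausdorff_univ_le fun χ => ⟨_, ⟨χ.comp hf, rfl⟩, mkDist_le_ofReal fun a ha => ?_⟩
  have hsa : IsSelfAdjoint ((a : A) - f (π a)) :=
    IsSelfAdjoint.sub a.2 (hf.isPositiveMap.isSelfAdjoint_map ((a.2 : IsSelfAdjoint _).map π))
  rw [State.pullback_apply, State.comp_apply, ← map_sub]
  exact (χ.norm_apply_le hsa).trans (h a ha)

lemma IsUnitalPositiveMap.prod {f : C →ₗ[ℂ] A} {g : C →ₗ[ℂ] B} (hf : IsUnitalPositiveMap f)
    (hg : IsUnitalPositiveMap g) : IsUnitalPositiveMap (f.prod g) where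
  isPositiveMap c :=
    have ⟨a, ha⟩ := hf.isPositiveMap c
    have ⟨b, hb⟩ := hg.isPositiveMap c
    ⟨(a, b), Prod.ext ha hb⟩
  map_one := Prod.ext hf.map_one hg.map_one

end Extent

section ApproxFactorization

variable {A B : Type u} [CStarAlgebra A] [CStarAlgebra B] {L : selfAdjoint A → ℝ≥0∞}
  {φ : B →ₗ[ℂ] A} {ψ : A →ₗ[ℂ] B} {δ η : ℝ≥0}

/-- The identity of `A` approximately factors through the unital positive maps `ψ` and `φ`, and `ψ`
is approximately compatible with the Jordan and Lie products; both errors are controlled by the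
seminorm `L`, uniformly over the whole domain. -/
structure IsApproxFactorization (L : selfAdjoint A → ℝ≥0∞) (φ : B →ₗ[ℂ] A) (ψ : A →ₗ[ℂ] B)
    (δ η : ℝ≥0) : Prop where
  left : IsUnitalPositiveMap φ
  right : IsUnitalPositiveMap ψ
  norm_sub_le : ∀ (a : selfAdjoint A) (l : ℝ≥0), L a ≤ l → ‖(a : A) - φ (ψ a)‖ ≤ δ * l
  norm_map_hermProd_sub_le : ∀ c ∈ jordanLieCoeffs, ∀ (a b : selfAdjoint A) (l m : ℝ≥0),
    L a ≤ l → L b ≤ m → ‖ψ (hermProd c (a : A) b) - hermProd c (ψ a) (ψ b)‖ ≤ η * δ * l * m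

namespace IsApproxFactorization

lemma norm_saFst_sub_le (h : IsApproxFactorization L φ ψ δ η) (hδ : 0 < δ)
    {d : selfAdjoint (A × B)} {l : ℝ≥0} (hd : tunnelLip L ψ δ d ≤ l) :
    ‖(saFst d : A) - φ (saSnd d : B)‖ ≤ 2 * δ * l := by
  obtain ⟨hfst, hsnd⟩ := (tunnelLip_le_iff hδ).1 hd
  have hsa : IsSelfAdjoint (ψ (saFst d : A) - saSnd d) :=
    (h.right.isPositiveMap.isSelfAdjoint_map (saFst d).2).sub (saSnd d).2
  calc ‖(saFst d : A) - φ (saSnd d : B)‖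
      = ‖((saFst d : A) - φ (ψ (saFst d))) + φ (ψ (saFst d : A) - saSnd d)‖ := by
        rw [map_sub, sub_add_sub_cancel]
    _ ≤ δ * l + δ * l :=
        norm_add_le_of_le (h.norm_sub_le _ _ hfst) ((h.left.norm_map_le hsa).trans hsnd)
    _ = 2 * δ * l := by ring

lemma nnnorm_le_nnnorm_saSnd_add (h : IsApproxFactorization L φ ψ δ η) (hδ : 0 < δ)
    {d : selfAdjoint (A × B)} {l : ℝ≥0} (hd : tunnelLip L ψ δ d ≤ l) :
    ‖d‖₊ ≤ ‖saSnd d‖₊ + 2 * δ * l := by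
  rw [← NNReal.coe_le_coe, coe_nnnorm, norm_selfAdjoint_prod]
  refine max_le ?_ (le_add_of_nonneg_right (2 * δ * l).2)
  calc ‖(saFst d : A)‖ = ‖φ (saSnd d : B) + ((saFst d : A) - φ (saSnd d : B))‖ := by
        rw [add_sub_cancel]
    _ ≤ ‖(saSnd d : B)‖ + 2 * δ * l :=
        norm_add_le_of_le (h.left.norm_map_le (saSnd d).2) (h.norm_saFst_sub_le hδ hd)

lemma satisfiesLeibniz_tunnelLip {F : ℝ≥0 → ℝ≥0 → ℝ≥0 → ℝ≥0 → ℝ≥0}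
    (h : IsApproxFactorization L φ ψ δ η) (hδ : 0 < δ) (hF : IsPermissible F) {c : ℂ}
    (hc : c ∈ jordanLieCoeffs) (hL : SatisfiesLeibniz F L (saHermProd c)) :
    SatisfiesLeibniz (fun x y lx ly => F x y lx ly + η * lx * ly) (tunnelLip L ψ δ)
      (saHermProd c) := by
  intro d e l m hd he
  obtain ⟨hdl, hdψ⟩ := (tunnelLip_le_iff hδ).1 hd
  obtain ⟨hem, heψ⟩ := (tunnelLip_le_iff hδ).1 he
  have hfst (d : selfAdjoint (A × B)) : ‖saFst d‖ ≤ ‖d‖ := le_max_left _ _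
  have hsnd (d : selfAdjoint (A × B)) : ‖saSnd d‖ ≤ ‖d‖ := le_max_right _ _
  refine (tunnelLip_le_iff hδ).2 ⟨(hL _ _ l m hdl hem).trans (ENNReal.coe_le_coe.2 ?_), ?_⟩
  · exact (hF.mono (hfst d) (hfst e) le_rfl le_rfl).trans le_self_add
  set a := saFst d
  set a' := saFst e
  have hψa : ‖ψ (a : A)‖ ≤ ‖d‖ := (h.right.norm_map_le a.2).trans (hfst d)
  have hleibniz : ‖d‖ * m + ‖e‖ * l ≤ F ‖d‖₊ ‖e‖₊ l m := hF.leibniz_le ‖d‖₊ ‖e‖₊ l m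
  calc ‖ψ (hermProd c (a : A) a') - hermProd c (saSnd d : B) (saSnd e)‖
      ≤ η * δ * l * m + (‖ψ (a : A)‖ * ‖ψ (a' : A) - saSnd e‖ +
          ‖ψ (a : A) - saSnd d‖ * ‖(saSnd e : B)‖) := by
        rw [← sub_add_sub_cancel _ (hermProd c (ψ (a : A)) (ψ a'))]
        exact norm_add_le_of_le (h.norm_map_hermProd_sub_le c hc a a' l m hdl hem)
          (norm_hermProd_sub_hermProd_le (norm_eq_of_mem_jordanLieCoeffs hc).le _ _ _ _)
    _ ≤ η * δ * l * m + (‖d‖ * (δ * m) + δ * l * ‖e‖) := by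
        gcongr
        exact hsnd e
    _ = δ * (‖d‖ * m + ‖e‖ * l + η * l * m) := by ring
    _ ≤ δ * (F ‖d‖₊ ‖e‖₊ l m + η * l * m : ℝ≥0) := by
        push_cast
        gcongr

variable [FiniteDimensional ℂ B]

lemma isQuasiLeibnizQCMS_tunnelLip {F : ℝ≥0 → ℝ≥0 → ℝ≥0 → ℝ≥0 → ℝ≥0}
    (h : IsApproxFactorization L φ ψ δ η) (hδ : 0 < δ) (hA : IsQuasiLeibnizQCMS F ⟨A, L⟩) :
    IsQuasiLeibnizQCMS (fun x y lx ly => F x y lx ly + η * lx * ly) ⟨A × B, tunnelLip L ψ δ⟩ := by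
  obtain ⟨hF, hL, hop⟩ := isQuasiLeibnizQCMS_iff.1 hA
  refine isQuasiLeibnizQCMS_iff.2 ⟨⟨fun _ _ _ _ _ _ _ _ hx hy hlx hly => ?_, fun x y lx ly => ?_⟩,
    hL.tunnelLip h.right hδ, fun c hc => h.satisfiesLeibniz_tunnelLip hδ hF hc (hop c hc)⟩
  · exact add_le_add (hF.mono hx hy hlx hly) (by gcongr)
  · exact (hF.leibniz_le x y lx ly).trans le_self_add

lemma isCDQuasiLeibnizQCMS_tunnelLip {C D : ℝ≥0} (h : IsApproxFactorization L φ ψ δ η)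
    (hδ : 0 < δ) (hC : 1 ≤ C) (hA : IsCDQuasiLeibnizQCMS C D ⟨A, L⟩) :
    IsCDQuasiLeibnizQCMS C (D + η) ⟨A × B, tunnelLip L ψ δ⟩ :=
  (h.isQuasiLeibnizQCMS_tunnelLip hδ hA).mono (isPermissible_cdFun hC _) fun x y lx ly =>
    (by unfold cdFun; ring : cdFun C D x y lx ly + η * lx * ly = cdFun C (D + η) x y lx ly).le

lemma isCDQuasiLeibnizQCMS_quotientLip {C D : ℝ≥0} (h : IsApproxFactorization L φ ψ δ η)
    (hδ : 0 < δ) (hC : 1 ≤ C) (hA : IsCDQuasiLeibnizQCMS C D ⟨A, L⟩) :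
    IsCDQuasiLeibnizQCMS C (D + η + 4 * C * δ) ⟨B, quotientLip (tunnelLip L ψ δ) saSnd⟩ := by
  obtain ⟨-, hL, hop⟩ := isQuasiLeibnizQCMS_iff.1 (h.isCDQuasiLeibnizQCMS_tunnelLip hδ hC hA)
  refine isQuasiLeibnizQCMS_iff.2 ⟨isPermissible_cdFun hC _,
    hL.quotientLip (fun b => ⟨saPair 0 b, rfl⟩) rfl, fun c hc => ?_⟩
  rw [show D + η + 4 * C * δ = D + η + 2 * C * (2 * δ) by ring]
  exact (hop c hc).quotientLip (fun _ _ => rfl) fun d l => h.nnnorm_le_nnnorm_saSnd_add hδ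

/-- The tunnel from `A` to `B` with the seminorm `tunnelLip`. -/
def tunnel {F : ℝ≥0 → ℝ≥0 → ℝ≥0 → ℝ≥0 → ℝ≥0} (h : IsApproxFactorization L φ ψ δ η)
    (hF : IsQuasiLeibnizQCMS F ⟨A × B, tunnelLip L ψ δ⟩) :
    Tunnel F ⟨A, L⟩ ⟨B, quotientLip (tunnelLip L ψ δ) saSnd⟩ where
  space := ⟨A × B, tunnelLip L ψ δ⟩
  isQCMS := hF
  left := StarAlgHom.fst ℂ A B
  right := StarAlgHom.snd ℂ A B
  left_surjective := Prod.fst_surjective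
  right_surjective := Prod.snd_surjective
  left_quotient a := by
    refine le_antisymm (le_iInf₂ fun d hd => ?_) ?_
    · rw [show a = saFst d from Subtype.ext hd.symm]
      exact le_max_left _ _
    · refine iInf₂_le_of_le
        (saPair a ⟨ψ a, h.right.isPositiveMap.isSelfAdjoint_map a.2⟩) rfl ?_
      simp [tunnelLip]
  right_quotient b := by simp only [quotientLip, Subtype.ext_iff]; rfl

omit [FiniteDimensional ℂ B] in
lemma extent_tunnel_le {F : ℝ≥0 → ℝ≥0 → ℝ≥0 → ℝ≥0 → ℝ≥0} (h : IsApproxFactorization L φ ψ δ η)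
    (hδ : 0 < δ) (hF : IsQuasiLeibnizQCMS F ⟨A × B, tunnelLip L ψ δ⟩) :
    (h.tunnel hF).extent ≤ ENNReal.ofReal (2 * δ) := by
  refine max_le
    (mkHausdorff_univ_range_pullback_le (IsUnitalPositiveMap.id.prod h.right)
      fun (d : selfAdjoint (A × B)) hd => ?_)
    (mkHausdorff_univ_range_pullback_le (h.left.prod .id)
      fun (d : selfAdjoint (A × B)) hd => ?_)
  · replace hd : tunnelLip L ψ δ d ≤ (1 : ℝ≥0) := hd
    have hψ := ((tunnelLip_le_iff hδ).1 hd).2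
    refine max_le ?_ ?_
    · change ‖(saFst d : A) - saFst d‖ ≤ 2 * δ
      simp
    · change ‖(saSnd d : B) - ψ (saFst d : A)‖ ≤ 2 * δ
      rw [norm_sub_rev]
      refine hψ.trans ?_
      simp [two_mul]
  · replace hd : tunnelLip L ψ δ d ≤ (1 : ℝ≥0) := hd
    refine max_le ?_ ?_
    · change ‖(saFst d : A) - φ (saSnd d : B)‖ ≤ 2 * δ
      simpa using h.norm_saFst_sub_le hδ hd
    · change ‖(saSnd d : B) - saSnd d‖ ≤ 2 * δ
      simp

end IsApproxFactorization

end ApproxFactorization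

section PseudoDiagonal

variable {A B : Type u} [CStarAlgebra A] [CStarAlgebra B] {φ : B →ₗ[ℂ] A} {ψ : A →ₗ[ℂ] B}

lemma norm_sub_map_map_le (hφ : IsUnitalPositiveMap φ) (hψ : IsUnitalPositiveMap ψ)
    (e s : selfAdjoint A) : ‖(e : A) - φ (ψ e)‖ ≤ 2 * ‖e - s‖ + ‖(s : A) - φ (ψ s)‖ := by
  calc ‖(e : A) - φ (ψ e)‖
      = ‖((e - s : selfAdjoint A) : A) - (φ ∘ₗ ψ) (e - s : selfAdjoint A) +
          ((s : A) - φ (ψ s))‖ := by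
        rw [AddSubgroup.coe_sub, map_sub]
        congr 1
        simp only [LinearMap.comp_apply]
        abel
    _ ≤ ‖e - s‖ + ‖e - s‖ + ‖(s : A) - φ (ψ s)‖ :=
        norm_add_le_of_le (norm_sub_le_of_le le_rfl ((hφ.comp hψ).norm_map_le (e - s).2)) le_rfl
    _ = 2 * ‖e - s‖ + ‖(s : A) - φ (ψ s)‖ := by ring

lemma norm_map_hermProd_sub_le_of_near (hψ : IsUnitalPositiveMap ψ) {c : ℂ} (hc : ‖c‖ ≤ 2⁻¹)
    (e f s t : selfAdjoint A) :
    ‖ψ (hermProd c (e : A) f) - hermProd c (ψ e) (ψ f)‖ ≤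
      2 * (‖e‖ * ‖f - t‖ + ‖e - s‖ * ‖t‖) +
        ‖ψ (hermProd c (s : A) t) - hermProd c (ψ s) (ψ t)‖ := by
  have hdom : ‖ψ (hermProd c (e : A) f) - ψ (hermProd c (s : A) t)‖ ≤
      ‖e‖ * ‖f - t‖ + ‖e - s‖ * ‖t‖ := by
    rw [← map_sub]
    exact (hψ.norm_map_le (saHermProd c e f - saHermProd c s t).2).trans
      (norm_hermProd_sub_hermProd_le hc _ _ _ _)
  have hcod : ‖hermProd c (ψ e) (ψ f) - hermProd c (ψ s) (ψ t)‖ ≤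
      ‖e‖ * ‖f - t‖ + ‖e - s‖ * ‖t‖ := by
    refine (norm_hermProd_sub_hermProd_le hc _ _ _ _).trans ?_
    rw [← map_sub, ← map_sub]
    gcongr
    exacts [hψ.norm_map_le e.2, hψ.norm_map_le (f - t).2, hψ.norm_map_le (e - s).2,
      hψ.norm_map_le t.2]
  calc ‖ψ (hermProd c (e : A) f) - hermProd c (ψ e) (ψ f)‖
      = ‖(ψ (hermProd c (e : A) f) - ψ (hermProd c (s : A) t)) -
          (hermProd c (ψ e) (ψ f) - hermProd c (ψ s) (ψ t)) +
          (ψ (hermProd c (s : A) t) - hermProd c (ψ s) (ψ t))‖ := by congr 1; abel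
    _ ≤ _ := by
        rw [two_mul]
        exact norm_add_le_of_le (norm_sub_le_of_le hdom hcod) le_rfl

lemma IsPseudoDiagonal.exists_of_totallyBounded (hA : IsPseudoDiagonal A)
    {E : Set (selfAdjoint A)} (hE : TotallyBounded E) {κ : ℝ} (hκ : 0 < κ) :
    ∃ (B : Type u) (_ : CStarAlgebra B) (_ : FiniteDimensional ℂ B)
      (φ : B →ₗ[ℂ] A) (ψ : A →ₗ[ℂ] B), IsUnitalPositiveMap φ ∧ IsUnitalPositiveMap ψ ∧
      (∀ e ∈ E, ‖(e : A) - φ (ψ e)‖ ≤ κ) ∧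
      ∀ c ∈ jordanLieCoeffs, ∀ e ∈ E, ∀ f ∈ E,
        ‖ψ (hermProd c (e : A) f) - hermProd c (ψ e) (ψ f)‖ ≤ κ := by
  obtain ⟨M, hM0, hM⟩ := hE.isBounded.exists_pos_norm_le
  set ρ := κ / (8 * (M + 1)) with hρ
  have hρ0 : 0 < ρ := by positivity
  have hρκ : 8 * (ρ * M) + 8 * ρ = κ := by rw [hρ]; field_simp
  obtain ⟨t, htE, ht, hcov⟩ := Metric.finite_approx_of_totallyBounded hE ρ hρ0
  have hnear (e) (he : e ∈ E) : ∃ s ∈ t, ‖e - s‖ ≤ ρ := by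
    obtain ⟨s, hs, hes⟩ := Set.mem_iUnion₂.1 (hcov he)
    exact ⟨s, hs, (mem_ball_iff_norm.1 hes).le⟩
  have hfin : (((↑) : selfAdjoint A → A) '' t).Finite := ht.image _
  have hmem (s) (hs : s ∈ t) : (s : A) ∈ hfin.toFinset := by simpa using hs
  obtain ⟨B, _, _, φ, ψ, hφ, hφ1, hψ, hψ1, hid, hj, hl⟩ := hA (κ / 2) (by positivity) hfin.toFinset
  have hop (c) (hc : c ∈ jordanLieCoeffs) : ∀ s ∈ t, ∀ s' ∈ t,
      ‖ψ (hermProd c (s : A) s') - hermProd c (ψ s) (ψ s')‖ ≤ κ / 2 := by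
    rcases hc with rfl | rfl
    · rw [hermProd_two_inv, hermProd_two_inv]
      exact fun s hs s' hs' => hj s (hmem s hs) s' (hmem s' hs')
    · rw [hermProd_two_I_inv, hermProd_two_I_inv]
      exact fun s hs s' hs' => hl s (hmem s hs) s' (hmem s' hs')
  refine ⟨B, _, ‹_›, φ, ψ, ⟨hφ, hφ1⟩, ⟨hψ, hψ1⟩, fun e he => ?_, fun c hc e he f hf => ?_⟩
  · obtain ⟨s, hs, hes⟩ := hnear e he
    have := norm_sub_map_map_le ⟨hφ, hφ1⟩ ⟨hψ, hψ1⟩ e s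
    have := hid s (hmem s hs)
    nlinarith
  · obtain ⟨s, hs, hes⟩ := hnear e he
    obtain ⟨s', hs', hfs⟩ := hnear f hf
    refine (norm_map_hermProd_sub_le_of_near ⟨hψ, hψ1⟩ (norm_eq_of_mem_jordanLieCoeffs hc).le
      e f s s').trans ?_
    have hsum : ‖e‖ * ‖f - s'‖ + ‖e - s‖ * ‖s'‖ ≤ M * ρ + ρ * M := by
      gcongr
      exacts [hM e he, hM s' (htE hs')]
    have := hop c hc s hs s' hs'
    nlinarith

theorem IsPseudoDiagonal.exists_isApproxFactorization (hA : IsPseudoDiagonal A)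
    {L : selfAdjoint A → ℝ≥0∞} (hL : IsLipNorm L) {δ η : ℝ≥0} (hδ : 0 < δ) (hη : 0 < η) :
    ∃ (B : Type u) (_ : CStarAlgebra B) (_ : FiniteDimensional ℂ B) (φ : B →ₗ[ℂ] A)
      (ψ : A →ₗ[ℂ] B), IsApproxFactorization L φ ψ δ η := by
  obtain ⟨E, hE, hLE⟩ := hL.exists_totallyBounded
  obtain ⟨B, _, _, φ, ψ, hφ, hψ, hid, hop⟩ :=
    hA.exists_of_totallyBounded hE (κ := min δ (η * δ)) (by positivity)
  refine ⟨B, _, ‹_›, φ, ψ, hφ, hψ, fun a l hl => ?_, fun c hc a b l m hl hm => ?_⟩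
  · obtain ⟨r, e, he, rfl⟩ := hLE a l hl
    have hdefect : ((r • 1 + (l : ℝ) • e : selfAdjoint A) : A) -
        φ (ψ (r • 1 + (l : ℝ) • e : selfAdjoint A)) = (l : ℝ) • ((e : A) - φ (ψ e)) := by
      simp only [AddSubgroup.coe_add, selfAdjoint.val_smul, selfAdjoint.val_one, map_add,
        hψ.map_smul_one, hφ.map_smul_one, LinearMap.map_smul_of_tower, add_sub_add_left_eq_sub,
        smul_sub]
    rw [hdefect, norm_smul, NNReal.norm_eq, mul_comm]
    gcongr
    exact (hid e he).trans (min_le_left _ _)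
  · obtain ⟨r, e, he, rfl⟩ := hLE a l hl
    obtain ⟨s, f, hf, rfl⟩ := hLE b m hm
    have hdefect : ψ (hermProd c ((r • 1 + (l : ℝ) • e : selfAdjoint A) : A)
          ((s • 1 + (m : ℝ) • f : selfAdjoint A) : A)) -
        hermProd c (ψ (r • 1 + (l : ℝ) • e : selfAdjoint A))
          (ψ (s • 1 + (m : ℝ) • f : selfAdjoint A)) =
        ((l : ℝ) * m) • (ψ (hermProd c (e : A) f) - hermProd c (ψ e) (ψ f)) := by
      simp only [AddSubgroup.coe_add, selfAdjoint.val_smul, selfAdjoint.val_one]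
      rw [map_hermProd_add_smul_one_sub hψ.map_one]
      simp only [hermProd, LinearMap.map_smul_of_tower, smul_mul_smul_comm, mul_comm (m : ℝ),
        smul_sub, ← smul_add, smul_comm _ ((l : ℝ) * m), map_add]
    rw [hdefect, norm_smul, Real.norm_of_nonneg (by positivity)]
    calc (l : ℝ) * m * ‖ψ (hermProd c (e : A) f) - hermProd c (ψ e) (ψ f)‖
        ≤ l * m * (η * δ) := by
          gcongr
          exact (hop c hc e he f hf).trans (min_le_right _ _)
      _ = η * δ * l * m := by ring

lemma exists_finiteDimensional_propinquity_le {C D ε r : ℝ≥0} {X : CStarPair.{u}} (hC : 1 ≤ C)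
    (hX : IsCDQuasiLeibnizQCMS C D X) (hpd : IsPseudoDiagonal X) (hε : 0 < ε) (hr : 0 < r) :
    ∃ Y : CStarPair.{u}, (IsCDQuasiLeibnizQCMS C (D + ε) Y ∧ FiniteDimensional ℂ Y) ∧
      propinquity (cdFun C (D + ε)) X Y ≤ r := by
  have _ : 0 < C := zero_lt_one.trans_le hC
  set δ := min (r / 2) (ε / (8 * C))
  have hδ : 0 < δ := by positivity
  have hδε : 4 * C * δ ≤ ε / 2 := calc
    4 * C * δ ≤ 4 * C * (ε / (8 * C)) := by gcongr; exact min_le_right _ _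
    _ = ε / 2 := by field_simp; norm_num
  obtain ⟨B, _, hB, φ, ψ, h⟩ := hpd.exists_isApproxFactorization
    (isQuasiLeibnizQCMS_iff.1 hX).2.1 hδ (half_pos hε)
  have hA := (h.isCDQuasiLeibnizQCMS_tunnelLip hδ hC hX).mono
    (isPermissible_cdFun hC (D + ε)) (cdFun_mono le_rfl (by gcongr; exact half_le_self ε.2))
  refine ⟨⟨B, _⟩, ⟨(h.isCDQuasiLeibnizQCMS_quotientLip hδ hC hX).mono
    (isPermissible_cdFun hC (D + ε)) (cdFun_mono le_rfl ?_), hB⟩,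
    (iInf_le _ (h.tunnel hA)).trans ((h.extent_tunnel_le hδ hA).trans ?_)⟩
  · calc D + ε / 2 + 4 * C * δ ≤ D + ε / 2 + ε / 2 := by gcongr
      _ = D + ε := by rw [add_assoc, add_halves]
  · rw [ENNReal.ofReal_le_coe]
    calc (2 : ℝ) * δ ≤ 2 * (r / 2) := by
          gcongr; exact_mod_cast min_le_left (r / 2) (ε / (8 * C))
      _ = r := by ring

theorem isLimitOfFiniteDimensional_of_isPseudoDiagonal {C D C' D' : ℝ≥0} {X : CStarPair.{u}}
    (hC : 1 ≤ C) (hX : IsCDQuasiLeibnizQCMS C D X) (hpd : IsPseudoDiagonal X) (hCC' : C ≤ C')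
    (hDD' : D < D') : IsLimitOfFiniteDimensional C' D' X := by
  have hC' : 1 ≤ C' := hC.trans hCC'
  obtain ⟨ε, hε, rfl⟩ : ∃ ε > 0, D' = D + ε :=
    ⟨D' - D, tsub_pos_of_lt hDD', (add_tsub_cancel_of_le hDD'.le).symm⟩
  have hXC' : IsCDQuasiLeibnizQCMS C' D X :=
    hX.mono (isPermissible_cdFun hC' D) (cdFun_mono hCC' le_rfl)
  choose Y hY hXY using fun n : ℕ => exists_finiteDimensional_propinquity_le hC' hXC' hpd hε
    (r := 1 / (n + 1)) (by positivity)
  refine ⟨hXC'.mono (isPermissible_cdFun hC' _) (cdFun_mono le_rfl le_self_add), Y, hY,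
    tendsto_of_tendsto_of_tendsto_of_le_of_le tendsto_const_nhds ?_ (fun _ => zero_le) hXY⟩
  exact ENNReal.tendsto_coe.2 (tendsto_one_div_add_atTop_nhds_zero_nat (𝕜 := ℝ≥0))

end PseudoDiagonal

/-! ### Asymptotic embeddings -/

section AsympEq

variable {ι : Type*} {l : Filter ι} {B C : ι → Type*}

/-- Two families of vectors in normed groups agree asymptotically along a filter: the norm of their
difference tends to zero. -/
def AsympEq [∀ i, SeminormedAddCommGroup (B i)] (l : Filter ι) (x y : ∀ i, B i) : Prop :=
  Tendsto (fun i => ‖x i - y i‖) l (𝓝 0)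

namespace AsympEq

section Group

variable [∀ i, SeminormedAddCommGroup (B i)] [∀ i, SeminormedAddCommGroup (C i)] {x y z : ∀ i, B i}

lemma of_norm_sub_le {x' y' : ∀ i, C i} (h : AsympEq l x y) (K : ℝ)
    (hle : ∀ i, ‖x' i - y' i‖ ≤ K * ‖x i - y i‖) : AsympEq l x' y' :=
  squeeze_zero (fun _ => norm_nonneg _) hle (by simpa using h.const_mul K)

lemma symm (h : AsympEq l x y) : AsympEq l y x :=
  h.of_norm_sub_le 1 fun i => by rw [norm_sub_rev, one_mul]

lemma trans (hxy : AsympEq l x y) (hyz : AsympEq l y z) : AsympEq l x z :=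
  squeeze_zero (fun _ => norm_nonneg _)
    (fun i => norm_sub_le_norm_sub_add_norm_sub (x i) (y i) (z i)) (by simpa using hxy.add hyz)

lemma sum {κ : Type*} (s : Finset κ) {x y : κ → ∀ i, B i} (h : ∀ k ∈ s, AsympEq l (x k) (y k)) :
    AsympEq l (fun i => ∑ k ∈ s, x k i) (fun i => ∑ k ∈ s, y k i) := by
  refine squeeze_zero (fun _ => norm_nonneg _) (fun i => ?_)
    (by simpa using tendsto_finsetSum s fun k hk => h k hk)
  rw [← Finset.sum_sub_distrib]
  exact norm_sum_le _ _

lemma eventually_norm_le_add (h : AsympEq l x y) {ε : ℝ} (hε : 0 < ε) :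
    ∀ᶠ i in l, ‖x i‖ ≤ ‖y i‖ + ε := by
  filter_upwards [h.eventually_lt_const hε] with i hi
  linarith [norm_le_norm_add_norm_sub' (x i) (y i)]

end Group

section Ring

variable [∀ i, NonUnitalNormedRing (B i)] {x y z : ∀ i, B i}

lemma mul_right (h : AsympEq l x y) {K : ℝ} (hz : ∀ i, ‖z i‖ ≤ K) :
    AsympEq l (fun i => x i * z i) (fun i => y i * z i) :=
  h.of_norm_sub_le K fun i => by
    rw [← sub_mul, mul_comm K]
    exact (norm_mul_le _ _).trans (by gcongr; exact hz i)

lemma mul_left (h : AsympEq l x y) {K : ℝ} (hz : ∀ i, ‖z i‖ ≤ K) :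
    AsympEq l (fun i => z i * x i) (fun i => z i * y i) :=
  h.of_norm_sub_le K fun i => by
    rw [← mul_sub]
    exact (norm_mul_le _ _).trans (by gcongr; exact hz i)

end Ring

end AsympEq

end AsympEq

section AsymptoticEmbedding

variable {ι : Type*} {l : Filter ι} {A : Type*} {B : ι → Type*} [CStarAlgebra A]
  [∀ i, CStarAlgebra (B i)] {θ θ' : ∀ i, A →ₗ[ℂ] B i}

/-- Along `l`, the uniformly bounded `*`-preserving maps `θ i` are asymptotically multiplicative and
bounded below. By `IsAsymptoticEmbedding.eventually_norm_le` they are then asymptotically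
isometric on self-adjoint elements. -/
structure IsAsymptoticEmbedding (l : Filter ι) (θ : ∀ i, A →ₗ[ℂ] B i) : Prop where
  map_star : ∀ i a, θ i (star a) = star (θ i a)
  exists_norm_map_le : ∃ K : ℝ≥0, ∀ i a, ‖θ i a‖ ≤ K * ‖a‖
  map_mul : ∀ a b, AsympEq l (fun i => θ i (a * b)) (fun i => θ i a * θ i b)
  exists_eventually_norm_le : ∃ K : ℝ≥0, ∀ a, ∀ ε : ℝ, 0 < ε → ∀ᶠ i in l, ‖a‖ ≤ K * ‖θ i a‖ + ε

namespace IsAsymptoticEmbedding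

lemma exists_eventually_norm_le_of_asympEq (hθ : IsAsymptoticEmbedding l θ) {y : A → ∀ i, B i}
    (h : ∀ a, AsympEq l (fun i => θ i a) (y a)) :
    ∃ K : ℝ≥0, ∀ a, ∀ ε : ℝ, 0 < ε → ∀ᶠ i in l, ‖a‖ ≤ K * ‖y a i‖ + ε := by
  obtain ⟨K, hK⟩ := hθ.exists_eventually_norm_le
  refine ⟨K, fun a ε hε => ?_⟩
  filter_upwards [hK a _ (half_pos hε), (h a).eventually_norm_le_add
    (show 0 < ε / 2 / (K + 1) by positivity)] with i hi hi'
  calc ‖a‖ ≤ K * (‖y a i‖ + ε / 2 / (K + 1)) + ε / 2 := hi.trans (by gcongr)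
    _ ≤ K * ‖y a i‖ + (K + 1) * (ε / 2 / (K + 1)) + ε / 2 := by
        rw [mul_add]; gcongr; linarith
    _ = K * ‖y a i‖ + ε := by field_simp; ring

lemma congr (hθ : IsAsymptoticEmbedding l θ)
    (hstar : ∀ i a, θ' i (star a) = star (θ' i a)) (hnorm : ∃ K : ℝ≥0, ∀ i a, ‖θ' i a‖ ≤ K * ‖a‖)
    (h : ∀ a, AsympEq l (fun i => θ i a) (fun i => θ' i a)) : IsAsymptoticEmbedding l θ' where
  map_star := hstar
  exists_norm_map_le := hnorm
  map_mul a b := by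
    obtain ⟨K, hK⟩ := hθ.exists_norm_map_le
    obtain ⟨K', hK'⟩ := hnorm
    exact (h (a * b)).symm.trans <| (hθ.map_mul a b).trans <|
      ((h a).mul_right (hK · b)).trans ((h b).mul_left (hK' · a))
  exists_eventually_norm_le := hθ.exists_eventually_norm_le_of_asympEq h

lemma map_pow_succ (hθ : IsAsymptoticEmbedding l θ) (a : A) (m : ℕ) :
    AsympEq l (fun i => θ i (a ^ (m + 1))) (fun i => θ i a ^ (m + 1)) := by
  obtain ⟨K, hK⟩ := hθ.exists_norm_map_le
  induction m with
  | zero => simpa [AsympEq] using tendsto_const_nhds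
  | succ m ih =>
    simp only [pow_succ _ (m + 1)]
    exact (hθ.map_mul _ _).trans (ih.mul_right (hK · a))

/- The constant in the lower bound disappears by applying it to a high power of `a`, since the
C*-identity gives `‖a ^ 2 ^ m‖ = ‖a‖ ^ 2 ^ m`. -/
lemma eventually_norm_le (hθ : IsAsymptoticEmbedding l θ) {a : A} (ha : IsSelfAdjoint a) {ε : ℝ}
    (hε : 0 < ε) : ∀ᶠ i in l, ‖a‖ ≤ ‖θ i a‖ + ε := by
  rcases le_or_gt ‖a‖ ε with h | h
  · exact .of_forall fun i => h.trans (le_add_of_nonneg_left (norm_nonneg _))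
  obtain ⟨K, hK⟩ := hθ.exists_eventually_norm_le
  obtain ⟨r, hr⟩ : ∃ r, r = ‖a‖ - ε := ⟨_, rfl⟩
  have hr0 : 0 < r := by linarith
  have har : 1 < ‖a‖ / r := by rw [one_lt_div hr0]; linarith
  obtain ⟨m, hm⟩ := pow_unbounded_of_one_lt (2 * K + 1 : ℝ) har
  have hlarge : (2 * K + 1) * r ^ 2 ^ m < ‖a‖ ^ 2 ^ m := by
    rw [← lt_div_iff₀ (by positivity), ← div_pow]
    exact hm.trans_le (pow_le_pow_right₀ har.le m.lt_two_pow_self.le)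
  have hpow : AsympEq l (fun i => θ i (a ^ 2 ^ m)) (fun i => θ i a ^ 2 ^ m) := by
    simpa [Nat.sub_add_cancel Nat.one_le_two_pow] using hθ.map_pow_succ a (2 ^ m - 1)
  filter_upwards [hK (a ^ 2 ^ m) _ (pow_pos hr0 (2 ^ m)),
    hpow.eventually_norm_le_add (pow_pos hr0 (2 ^ m))] with i hlower hupper
  by_contra! hlt
  refine hlarge.not_ge ?_
  have hsa : IsSelfAdjoint (θ i a) := by rw [isSelfAdjoint_iff, ← hθ.map_star, ha.star_eq]
  calc ‖a‖ ^ 2 ^ m = ‖a ^ 2 ^ m‖ := (ha.norm_pow_two_pow m).symm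
    _ ≤ K * (‖θ i a ^ 2 ^ m‖ + r ^ 2 ^ m) + r ^ 2 ^ m := hlower.trans (by gcongr)
    _ = K * (‖θ i a‖ ^ 2 ^ m + r ^ 2 ^ m) + r ^ 2 ^ m := by rw [hsa.norm_pow_two_pow]
    _ ≤ K * (r ^ 2 ^ m + r ^ 2 ^ m) + r ^ 2 ^ m := by gcongr; linarith
    _ = (2 * K + 1) * r ^ 2 ^ m := by ring

lemma eventually_forall_norm_le (hθ : IsAsymptoticEmbedding l θ) {S : Set A} (hS : IsCompact S)
    (hsa : ∀ a ∈ S, IsSelfAdjoint a) {ε : ℝ} (hε : 0 < ε) :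
    ∀ᶠ i in l, ∀ a ∈ S, ‖a‖ ≤ ‖θ i a‖ + ε := by
  obtain ⟨K, hK⟩ := hθ.exists_norm_map_le
  refine hS.induction_on (p := fun T => ∀ᶠ i in l, ∀ a ∈ T, ‖a‖ ≤ ‖θ i a‖ + ε) (by simp)
    (fun s t hst ht => ht.mono fun i h a ha => h a (hst ha)) (fun s t hs ht => ?_) fun a ha => ?_
  · filter_upwards [hs, ht] with i hsi hti a ha
    exact ha.elim (hsi a) (hti a)
  · set ρ := ε / 2 / (1 + K) with hρ
    have hρε : ρ + K * ρ = ε / 2 := by rw [hρ]; field_simp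
    refine ⟨Metric.ball a ρ,
      mem_nhdsWithin_of_mem_nhds (Metric.ball_mem_nhds a (by positivity)), ?_⟩
    filter_upwards [hθ.eventually_norm_le (hsa a ha) (half_pos hε)] with i hi b hb
    rw [mem_ball_iff_norm] at hb
    have hdom := norm_le_norm_add_norm_sub' b a
    have hcod : ‖θ i a‖ ≤ ‖θ i b‖ + K * ρ :=
      (norm_le_norm_add_norm_sub (θ i b) (θ i a)).trans <| by
        rw [← map_sub]; gcongr; exact (hK i _).trans (by gcongr)
    linarith

end IsAsymptoticEmbedding

end AsymptoticEmbedding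

/-! ### Quasi-diagonal algebras -/

section Unitalize

variable {A B : Type*} [CStarAlgebra A] [CStarAlgebra B] {θ : A →ₗ[ℂ] B}

/-- The unital map `θ + ω(·) (1 - θ 1)`; it is positive when `θ` is positive and contractive at
`1`. -/
def unitalize (θ : A →ₗ[ℂ] B) (ω : State A) : A →ₗ[ℂ] B :=
  θ + ω.toLinearMap.smulRight (1 - θ 1)

lemma isUnitalPositiveMap_unitalize (hθ : IsPositiveMap θ) (h1 : ‖θ 1‖ ≤ 1) (ω : State A) :
    IsUnitalPositiveMap (unitalize θ ω) where
  isPositiveMap := by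
    refine hθ.add (isPositiveMap_iff.2 fun a ha => ?_)
    have hdefect : 0 ≤ 1 - θ 1 := sub_nonneg.2 <|
      (CStarAlgebra.norm_le_one_iff_of_nonneg _ (isPositiveMap_iff.1 hθ 1 zero_le_one)).1 h1
    exact smul_nonneg (isPositiveMap_iff.1 ω.isUnitalPositiveMap.isPositiveMap a ha) hdefect
  map_one := by simp [unitalize, ω.map_one]

lemma norm_unitalize_sub_le (θ : A →ₗ[ℂ] B) (ω : State A) (a : A) :
    ‖unitalize θ ω a - θ a‖ ≤ 2 * ‖a‖ * ‖1 - θ 1‖ := by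
  rw [unitalize, LinearMap.add_apply, add_sub_cancel_left, LinearMap.smulRight_apply, norm_smul]
  gcongr
  exact ω.isUnitalPositiveMap.norm_map_le_two_mul a

end Unitalize

section Projections

lemma exists_continuous_rounding : ∃ f : ℝ → ℝ, Continuous f ∧
    ∀ x, |x - x * x| ≤ 1 / 8 → f x * f x = f x ∧ |f x - x| ≤ 2 * |x - x * x| := by
  obtain ⟨f, hf⟩ : ∃ f : ℝ → ℝ, f = fun x => max 0 (min 1 (2 * x - 1 / 2)) := ⟨_, rfl⟩
  refine ⟨f, by rw [hf]; fun_prop, fun x hx => ?_⟩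
  have hfactor : |x - x * x| = |x| * |1 - x| := by rw [← abs_mul]; ring_nf
  rcases le_or_gt x (1 / 4) with hx' | hx'
  · have hfx : f x = 0 := by
      rw [hf]; exact max_eq_left ((min_le_right _ _).trans (by linarith))
    rw [hfx, zero_sub, abs_neg, hfactor]
    exact ⟨mul_zero 0, by nlinarith [abs_nonneg x, le_abs_self (1 - x)]⟩
  · have hx'' : 3 / 4 ≤ x := by nlinarith [(abs_le.1 hx).2]
    have hfx : f x = 1 := by
      rw [hf]; exact (max_eq_right (le_min zero_le_one (by linarith))).trans
        (min_eq_left (by linarith))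
    rw [hfx, hfactor]
    exact ⟨mul_one 1, by nlinarith [abs_nonneg (1 - x), le_abs_self x]⟩

lemma exists_isStarProjection_norm_sub_le {B : Type*} [CStarAlgebra B] {h : B}
    (hsa : IsSelfAdjoint h) (hh : ‖h - h * h‖ ≤ 1 / 8) :
    ∃ p : B, IsStarProjection p ∧ ‖p - h‖ ≤ 2 * ‖h - h * h‖ := by
  obtain ⟨f, hf, hround⟩ := exists_continuous_rounding
  have hspec : ∀ x ∈ spectrum ℝ h, |x - x * x| ≤ ‖h - h * h‖ := fun x hx => by
    have hcfc : h - h * h = cfc (fun x : ℝ => x - x * x) h := by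
      rw [cfc_sub (fun x : ℝ => x) (fun x => x * x) h, cfc_mul (fun x : ℝ => x) (fun x => x) h,
        cfc_id' ℝ h]
    rw [hcfc]
    exact norm_apply_le_norm_cfc (fun x : ℝ => x - x * x) h hx
  refine ⟨cfc f h, ⟨?_, cfc_predicate f h⟩, ?_⟩
  · rw [IsIdempotentElem, ← cfc_mul f f h]
    exact cfc_congr fun x hx => (hround x ((hspec x hx).trans hh)).1
  · have hsub : cfc f h - h = cfc (fun x => f x - x) h := by
      rw [cfc_sub f (fun x : ℝ => x) h, cfc_id' ℝ h]
    rw [hsub]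
    refine norm_cfc_le (by positivity) fun x hx => ?_
    exact (hround x ((hspec x hx).trans hh)).2.trans (by gcongr; exact hspec x hx)

lemma AsympEq.exists_isStarProjection {ι : Type*} {l : Filter ι} {B : ι → Type*}
    [∀ i, CStarAlgebra (B i)] {h : ∀ i, B i} (hsa : ∀ i, IsSelfAdjoint (h i))
    (hh : AsympEq l h fun i => h i * h i) :
    ∃ p : ∀ i, B i, (∀ i, IsStarProjection (p i)) ∧ AsympEq l p h := by
  have hex : ∀ i, ∃ p : B i, IsStarProjection p ∧
      (‖h i - h i * h i‖ ≤ 1 / 8 → ‖p - h i‖ ≤ 2 * ‖h i - h i * h i‖) := fun i => by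
    by_cases hi : ‖h i - h i * h i‖ ≤ 1 / 8
    · obtain ⟨p, hp, hph⟩ := exists_isStarProjection_norm_sub_le (hsa i) hi
      exact ⟨p, hp, fun _ => hph⟩
    · exact ⟨0, .zero _, fun hi' => absurd hi' hi⟩
  choose p hp hph using hex
  refine ⟨p, hp, squeeze_zero' (.of_forall fun _ => norm_nonneg _) ?_
    (by simpa using hh.const_mul 2)⟩
  filter_upwards [hh.eventually_le_const (show (0 : ℝ) < 1 / 8 by norm_num)] with i hi
  exact hph i hi

end Projections

section Compression

open ContinuousLinearMap

variable {H : Type*} [NormedAddCommGroup H] [InnerProductSpace ℂ H] [CompleteSpace H]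
  (U : Submodule ℂ H) [CompleteSpace U]

/-- The compression `x ↦ P_U x|_U` of operators to a closed subspace `U`. -/
def compression : (H →L[ℂ] H) →ₗ[ℂ] (U →L[ℂ] U) where
  toFun x := adjoint U.subtypeL ∘L x ∘L U.subtypeL
  map_add' x y := by ext; simp
  map_smul' r x := by ext; simp

lemma subtypeL_comp_adjoint : U.subtypeL ∘L adjoint U.subtypeL = U.starProjection := by
  ext v
  rw [U.adjoint_subtypeL]
  rfl

lemma compression_starProjection : compression U U.starProjection = 1 := by
  ext v
  simp [compression, U.adjoint_subtypeL]

lemma compression_mul_compression (x y : H →L[ℂ] H) :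
    compression U x * compression U y = compression U (x * U.starProjection * y) := by
  rw [← subtypeL_comp_adjoint]
  rfl

lemma norm_adjoint_subtypeL_le : ‖adjoint U.subtypeL‖ ≤ 1 := by
  rw [LinearIsometryEquiv.norm_map]
  exact U.norm_subtypeL_le

lemma norm_compression_le (x : H →L[ℂ] H) : ‖compression U x‖ ≤ ‖x‖ :=
  calc ‖compression U x‖ ≤ ‖adjoint U.subtypeL‖ * (‖x‖ * ‖U.subtypeL‖) :=
        (opNorm_comp_le _ _).trans (by gcongr; exact opNorm_comp_le _ _)
    _ ≤ 1 * (‖x‖ * 1) := by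
        gcongr
        exacts [norm_adjoint_subtypeL_le U, U.norm_subtypeL_le]
    _ = ‖x‖ := by ring

lemma norm_starProjection_mul_mul_le (x : H →L[ℂ] H) :
    ‖U.starProjection * x * U.starProjection‖ ≤ ‖compression U x‖ :=
  calc ‖U.starProjection * x * U.starProjection‖
      = ‖U.subtypeL ∘L compression U x ∘L adjoint U.subtypeL‖ := by
        rw [← subtypeL_comp_adjoint]; rfl
    _ ≤ ‖U.subtypeL‖ * (‖compression U x‖ * ‖adjoint U.subtypeL‖) :=
        (opNorm_comp_le _ _).trans (by gcongr; exact opNorm_comp_le _ _)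
    _ ≤ 1 * (‖compression U x‖ * 1) := by
        gcongr
        exacts [U.norm_subtypeL_le, norm_adjoint_subtypeL_le U]
    _ = ‖compression U x‖ := by ring

lemma isPositiveMap_compression :
    IsPositiveMap (A := H →L[ℂ] H) (B := U →L[ℂ] U) (compression U) :=
  isPositiveMap_iff.2 fun x hx => (nonneg_iff_isPositive _).2 <|
    ((nonneg_iff_isPositive x).1 hx).adjoint_conj U.subtypeL

/- Since `θ i a * P ≈ θ i a * θ i 1 ≈ θ i a`, cutting down by a projection `P ≈ θ i 1` changes
neither products nor norms asymptotically. -/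
lemma IsAsymptoticEmbedding.compression_comp {ι : Type*} {l : Filter ι} {A : Type*}
    [CStarAlgebra A] {H : ι → Type*} [∀ i, NormedAddCommGroup (H i)]
    [∀ i, InnerProductSpace ℂ (H i)] [∀ i, CompleteSpace (H i)]
    {θ : ∀ i, A →ₗ[ℂ] (H i →L[ℂ] H i)} (hθ : IsAsymptoticEmbedding l θ)
    {U : ∀ i, Submodule ℂ (H i)} [∀ i, CompleteSpace (U i)]
    (hU : AsympEq l (fun i => (U i).starProjection) fun i => θ i 1) :
    IsAsymptoticEmbedding (B := fun i => U i →L[ℂ] U i) l fun i => compression (U i) ∘ₗ θ i := by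
  obtain ⟨K, hK⟩ := hθ.exists_norm_map_le
  have hright : ∀ a, AsympEq l (fun i => θ i a * (U i).starProjection) fun i => θ i a := fun a =>
    (hU.mul_left (hK · a)).trans (by simpa using (hθ.map_mul a 1).symm)
  have hleft : ∀ a, AsympEq l (fun i => (U i).starProjection * θ i a) fun i => θ i a := fun a =>
    (hU.mul_right (hK · a)).trans (by simpa using (hθ.map_mul 1 a).symm)
  have hcompression : ∀ {x y : ∀ i, H i →L[ℂ] H i}, AsympEq l x y →
      AsympEq l (fun i => compression (U i) (x i)) fun i => compression (U i) (y i) := fun h =>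
    h.of_norm_sub_le 1 fun i => by rw [← map_sub, one_mul]; exact norm_compression_le _ _
  refine ⟨fun i a => ?_, ⟨K, fun i a => (norm_compression_le _ _).trans (hK i a)⟩,
    fun a b => ?_, ?_⟩
  · rw [LinearMap.comp_apply, hθ.map_star, (isPositiveMap_compression _).map_star]
    rfl
  · simp only [LinearMap.comp_apply, compression_mul_compression]
    exact hcompression ((hθ.map_mul a b).trans ((hright a).symm.mul_right (hK · b)))
  · obtain ⟨M, hM⟩ := hθ.exists_eventually_norm_le_of_asympEq fun a =>
      (((hleft a).mul_right fun i => (U i).starProjection_norm_le).trans (hright a)).symm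
    refine ⟨M, fun a ε hε => (hM a ε hε).mono fun i hi => hi.trans ?_⟩
    gcongr
    exact norm_starProjection_mul_mul_le _ _

end Compression

section QuasiDiagonal

/-- The full matrix algebra as the operators on a Hilbert space in an arbitrary universe. -/
def matrixOperator (n : ℕ) : CStarMatrix (Fin n) (Fin n) ℂ ≃⋆ₐ[ℂ]
    (EuclideanSpace ℂ (ULift.{u} (Fin n)) →L[ℂ] EuclideanSpace ℂ (ULift.{u} (Fin n))) :=
  (CStarMatrix.reindexₐ ℂ ℂ Equiv.ulift.symm).trans
    (CStarMatrix.ofMatrixStarAlgEquiv.symm.trans Matrix.toEuclideanCLM)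

lemma isPositiveMap_starAlgHom {A B : Type*} [CStarAlgebra A] [CStarAlgebra B]
    (π : A →⋆ₐ[ℂ] B) : IsPositiveMap π.toAlgHom.toLinearMap :=
  fun a => ⟨π a, (map_mul π _ _).trans (congrArg (· * π a) (map_star π a))⟩

lemma eventually_subset_and_lt {A : Type*} (S : Finset A) {ε : ℝ} (hε : 0 < ε) :
    ∀ᶠ i : Finset A × ℕ in atTop, S ⊆ i.1 ∧ 1 / ((i.2 : ℝ) + 1) < ε := by
  classical
  obtain ⟨N, hN⟩ := exists_nat_one_div_lt hε
  filter_upwards [eventually_ge_atTop (S, N)] with i hi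
  exact ⟨hi.1, (Nat.one_div_le_one_div hi.2).trans_lt hN⟩

variable {A : Type u} [CStarAlgebra A]

lemma IsCompletelyPositive.isPositiveMap {B : Type*} [CStarAlgebra B] {φ : A →ₗ[ℂ] B}
    (hφ : IsCompletelyPositive φ) : IsPositiveMap φ := by
  intro a
  obtain ⟨N, hN⟩ := hφ 1 (CStarMatrix.ofMatrix fun _ _ => a)
  refine ⟨N 0 0, ?_⟩
  have hentry := congrArg (fun M : CStarMatrix (Fin 1) (Fin 1) B => M 0 0) hN
  simp only [CStarMatrix.map_apply, CStarMatrix.mul_apply, CStarMatrix.star_apply,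
    Finset.univ_unique, Fin.default_eq_zero, Finset.sum_singleton] at hentry
  exact hentry

lemma IsQuasiDiagonal.exists_isPositiveMap_operator (hA : IsQuasiDiagonal A) :
    ∃ (n : Finset A × ℕ → ℕ) (θ : ∀ i, A →ₗ[ℂ] (EuclideanSpace ℂ (ULift.{u} (Fin (n i))) →L[ℂ]
      EuclideanSpace ℂ (ULift.{u} (Fin (n i))))),
      (∀ i, IsPositiveMap (θ i)) ∧ (∀ i a, ‖θ i a‖ ≤ ‖a‖) ∧ IsAsymptoticEmbedding atTop θ := by
  classical
  choose n ψ hψ hmul hlower using fun i : Finset A × ℕ =>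
    hA _ (Nat.one_div_pos_of_nat (α := ℝ) (n := i.2)) i.1
  have hρ : ∀ i x, ‖matrixOperator.{u} (n i) x‖ = ‖x‖ := fun i x =>
    NonUnitalStarAlgHom.norm_map (matrixOperator (n i)) (matrixOperator (n i)).injective x
  have hpos : ∀ i, IsPositiveMap
      ((matrixOperator.{u} (n i)).toStarAlgHom.toAlgHom.toLinearMap ∘ₗ ψ i) :=
    fun i => (isPositiveMap_starAlgHom _).comp (hψ i).1.isPositiveMap
  have hnorm : ∀ i a, ‖matrixOperator.{u} (n i) (ψ i a)‖ ≤ ‖a‖ := fun i a =>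
    (hρ i _).trans_le ((hψ i).2 a)
  refine ⟨n, fun i => _, hpos, hnorm, fun i => (hpos i).map_star, ⟨1, by simpa using hnorm⟩,
    fun a b => ?_, 1, fun a ε hε => ?_⟩
  · refine Metric.tendsto_nhds.2 fun ε hε => ?_
    filter_upwards [eventually_subset_and_lt {a, b} hε] with i ⟨hsub, hi⟩
    rw [Real.dist_0_eq_abs, abs_norm]
    change ‖matrixOperator (n i) _ - matrixOperator (n i) _ * matrixOperator (n i) _‖ < ε
    rw [← map_mul, ← map_sub, hρ]
    exact (hmul i a (hsub (by simp)) b (hsub (by simp))).trans_lt hi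
  · filter_upwards [eventually_subset_and_lt {a} hε] with i ⟨hsub, hi⟩
    change ‖a‖ ≤ (1 : ℝ) * ‖matrixOperator (n i) (ψ i a)‖ + ε
    rw [one_mul, hρ]
    exact (hlower i a (hsub (by simp))).trans (by gcongr)

theorem IsQuasiDiagonal.exists_isUnitalPositiveMap [Nontrivial A] (hA : IsQuasiDiagonal A) :
    ∃ (B : Finset A × ℕ → Type u) (_ : ∀ i, CStarAlgebra (B i))
      (_ : ∀ i, FiniteDimensional ℂ (B i)) (θ : ∀ i, A →ₗ[ℂ] B i),
      (∀ i, IsUnitalPositiveMap (θ i)) ∧ IsAsymptoticEmbedding atTop θ := by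
  obtain ⟨n, θ, hpos, hnorm, hθ⟩ := hA.exists_isPositiveMap_operator
  obtain ⟨ω⟩ : Nonempty (State A) := inferInstance
  obtain ⟨P, hP, hPθ⟩ := AsympEq.exists_isStarProjection
    (fun i => (hpos i).isSelfAdjoint_map (.one A)) (by simpa using hθ.map_mul 1 1)
  choose U _ hU using fun i => isStarProjection_iff_eq_starProjection.1 (hP i)
  obtain rfl : P = fun i => (U i).starProjection := funext hU
  have hτ : ∀ i, IsPositiveMap (B := U i →L[ℂ] U i) (compression (U i) ∘ₗ θ i) := fun i =>
    (isPositiveMap_compression _).comp (hpos i)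
  have hτ1 : ∀ i, ‖(compression (U i) ∘ₗ θ i) 1‖ ≤ 1 := fun i =>
    (norm_compression_le _ _).trans ((hnorm i 1).trans CStarRing.norm_one.le)
  have hunital : ∀ i, IsUnitalPositiveMap (B := U i →L[ℂ] U i)
      (unitalize (compression (U i) ∘ₗ θ i) ω) := fun i =>
    isUnitalPositiveMap_unitalize (hτ i) (hτ1 i) ω
  have hone : AsympEq (B := fun i => U i →L[ℂ] U i) atTop (fun _ => 1)
      fun i => compression (U i) (θ i 1) :=
    hPθ.of_norm_sub_le 1 fun i => by
      rw [← compression_starProjection (U i), ← map_sub, one_mul]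
      exact norm_compression_le _ _
  refine ⟨fun i => U i →L[ℂ] U i, fun i => inferInstance, fun i => inferInstance, fun i => _,
    hunital, (hθ.compression_comp hPθ).congr (fun i => (hunital i).isPositiveMap.map_star)
      ⟨2, fun i => (hunital i).norm_map_le_two_mul⟩ fun a => ?_⟩
  refine AsympEq.symm (hone.of_norm_sub_le (2 * ‖a‖) fun i => ?_)
  exact norm_unitalize_sub_le _ _ _

end QuasiDiagonal

section MatrixUnits

variable {n : Type*} [DecidableEq n]

/-- The linear inclusion of `A` as the `(i, j)` entry of the matrices over `A`, the bundled form of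
`Matrix.single`. -/
def singleEntry {A : Type*} [AddCommMonoid A] [Module ℂ A] (i j : n) :
    A →ₗ[ℂ] CStarMatrix n n A where
  toFun a := CStarMatrix.ofMatrix (Matrix.single i j a)
  map_add' a b := Matrix.single_add i j a b
  map_smul' r a := (Matrix.smul_single r i j a).symm

variable {A : Type*} [CStarAlgebra A]

lemma singleEntry_apply (i j : n) (a : A) (k l : n) :
    singleEntry i j a k l = if i = k ∧ j = l then a else 0 := rfl

lemma star_singleEntry (i j : n) (a : A) : star (singleEntry i j a) = singleEntry j i (star a) :=
  Matrix.conjTranspose_single i j a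

lemma mapₗ_singleEntry {B : Type*} [CStarAlgebra B] (f : A →ₗ[ℂ] B) (i j : n) (a : A) :
    (singleEntry i j a).mapₗ f = singleEntry i j (f a) := by
  ext k l
  change f (singleEntry i j a k l) = _
  rw [singleEntry_apply, singleEntry_apply, apply_ite f, map_zero]

variable [Fintype n]

lemma singleEntry_mul_singleEntry (i j k : n) (a b : A) :
    singleEntry i j a * singleEntry j k b = singleEntry i k (a * b) :=
  Matrix.single_mul_single_same a i j k b

lemma sum_singleEntry (M : CStarMatrix n n A) : ∑ i, ∑ j, singleEntry i j (M i j) = M :=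
  (Matrix.matrix_eq_sum_single (CStarMatrix.ofMatrix.symm M)).symm

lemma norm_singleEntry_le (i j : n) (a : A) : ‖singleEntry i j a‖ ≤ ‖a‖ := by
  let corner : A →⋆ₙₐ[ℂ] CStarMatrix n n A :=
    { singleEntry j j with
      map_zero' := map_zero (singleEntry j j)
      map_mul' := fun a b => (singleEntry_mul_singleEntry j j j a b).symm
      map_star' := fun a => (star_singleEntry j j a).symm }
  refine abs_le_of_sq_le_sq' ?_ (norm_nonneg a) |>.2
  rw [sq, sq, ← CStarRing.norm_star_mul_self, ← CStarRing.norm_star_mul_self, star_singleEntry,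
    singleEntry_mul_singleEntry]
  exact NonUnitalStarAlgHom.norm_apply_le corner _

end MatrixUnits

section Amplification

variable {n : Type*}

lemma IsUnitalPositiveMap.mapₗ_one [DecidableEq n] {A B : Type*} [CStarAlgebra A] [CStarAlgebra B]
    {θ : A →ₗ[ℂ] B} (hθ : IsUnitalPositiveMap θ) : (1 : CStarMatrix n n A).mapₗ θ = 1 := by
  ext p q
  change θ ((1 : CStarMatrix n n A) p q) = _
  rw [CStarMatrix.one_apply, CStarMatrix.one_apply, apply_ite θ, hθ.map_one, map_zero]

variable [Fintype n]

lemma norm_le_sum_norm_entry {A : Type*} [CStarAlgebra A] (M : CStarMatrix n n A) :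
    ‖M‖ ≤ ∑ p, ∑ q, ‖M p q‖ := by
  classical
  conv_lhs => rw [← sum_singleEntry M]
  exact norm_sum_le_of_le _ fun p _ => norm_sum_le_of_le _ fun q _ => norm_singleEntry_le p q _

lemma norm_le_card_sq_mul {A : Type*} [CStarAlgebra A] {M : CStarMatrix n n A} {r : ℝ}
    (hM : ∀ p q, ‖M p q‖ ≤ r) : ‖M‖ ≤ Fintype.card n ^ 2 * r :=
  calc ‖M‖ ≤ ∑ p, ∑ q, ‖M p q‖ := norm_le_sum_norm_entry M
    _ ≤ ∑ _p : n, ∑ _q : n, r := Finset.sum_le_sum fun p _ => Finset.sum_le_sum fun q _ => hM p q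
    _ = Fintype.card n ^ 2 * r := by simp; ring

variable {ι : Type*} {l : Filter ι} {B : ι → Type*} [∀ i, CStarAlgebra (B i)]

lemma AsympEq.of_entries {M N : ∀ i, CStarMatrix n n (B i)}
    (h : ∀ p q, AsympEq l (fun i => M i p q) fun i => N i p q) : AsympEq l M N := by
  refine squeeze_zero (fun _ => norm_nonneg _) (fun i => norm_le_sum_norm_entry _) ?_
  simpa using tendsto_finsetSum _ fun p _ => tendsto_finsetSum _ fun q _ => h p q

/- Boundedness and the lower bound hold entrywise, at the price of a factor depending on the size of
the matrices; this is why `IsAsymptoticEmbedding` does not ask for isometry. -/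
lemma IsAsymptoticEmbedding.mapₗ [DecidableEq n] {A : Type*} [CStarAlgebra A]
    {θ : ∀ i, A →ₗ[ℂ] B i} (hθ : IsAsymptoticEmbedding l θ) :
    IsAsymptoticEmbedding l fun i => CStarMatrix.mapₗ (m := n) (n := n) (θ i) where
  map_star i M := by
    ext p q
    exact hθ.map_star i (M q p)
  exists_norm_map_le := by
    obtain ⟨K, hK⟩ := hθ.exists_norm_map_le
    refine ⟨Fintype.card n ^ 2 * K, fun i M => ?_⟩
    refine (norm_le_card_sq_mul fun p q => (hK i (M p q)).trans
      (mul_le_mul_of_nonneg_left CStarMatrix.norm_entry_le_norm K.2)).trans_eq ?_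
    push_cast
    ring
  map_mul M N := AsympEq.of_entries fun p q => by
    change AsympEq l (fun i => θ i ((M * N) p q))
      fun i => ((CStarMatrix.mapₗ (θ i) M : CStarMatrix n n (B i)) * CStarMatrix.mapₗ (θ i) N) p q
    simp only [CStarMatrix.mul_apply, map_sum]
    exact AsympEq.sum _ fun k _ => hθ.map_mul (M p k) (N k q)
  exists_eventually_norm_le := by
    obtain ⟨K, hK⟩ := hθ.exists_eventually_norm_le
    refine ⟨Fintype.card n ^ 2 * K, fun M ε hε => ?_⟩
    have hentry := eventually_all.2 fun p => eventually_all.2 fun q =>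
      hK (M p q) (ε / (Fintype.card n ^ 2 + 1)) (by positivity)
    filter_upwards [hentry] with i hi
    calc ‖M‖ ≤ Fintype.card n ^ 2 *
          (K * ‖CStarMatrix.mapₗ (θ i) M‖ + ε / (Fintype.card n ^ 2 + 1)) :=
          norm_le_card_sq_mul fun p q => (hi p q).trans <| by
            gcongr
            exact CStarMatrix.norm_entry_le_norm (M := CStarMatrix.mapₗ (θ i) M)
      _ ≤ Fintype.card n ^ 2 * (K * ‖CStarMatrix.mapₗ (θ i) M‖) + ε := by
          rw [mul_add]
          gcongr
          rw [mul_div_assoc', div_le_iff₀ (by positivity)]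
          linarith
      _ = _ := by push_cast; ring

end Amplification

/-! ### Approximate extension of positive functionals -/

lemma exists_norm_sub_le_of_forall_inner_le {E : Type*} [NormedAddCommGroup E]
    [InnerProductSpace ℝ E] {K : Set E} (hK : IsComplete K) (hconv : Convex ℝ K) {u : E} {δ : ℝ}
    (h : ∀ c : E, ‖c‖ ≤ 1 → ∃ w ∈ K, inner ℝ c u ≤ inner ℝ c w + δ) :
    ∃ v ∈ K, ‖u - v‖ ≤ δ := by
  obtain ⟨w₀, hw₀, hδ⟩ := h 0 (by simp)
  obtain ⟨v, hv, hmin⟩ := exists_norm_eq_iInf_of_complete_convex ⟨w₀, hw₀⟩ hK hconv u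
  rw [norm_eq_iInf_iff_real_inner_le_zero hconv hv] at hmin
  refine ⟨v, hv, ?_⟩
  rcases eq_or_ne (u - v) 0 with h0 | h0
  · simpa [h0] using hδ
  have hpos : 0 < ‖u - v‖ := norm_pos_iff.2 h0
  obtain ⟨w, hw, hcw⟩ := h (‖u - v‖⁻¹ • (u - v))
    (by rw [norm_smul, norm_inv, norm_norm, inv_mul_cancel₀ hpos.ne'])
  have hwv : inner ℝ (‖u - v‖⁻¹ • (u - v)) (w - v) ≤ 0 := by
    rw [real_inner_smul_left]
    exact mul_nonpos_of_nonneg_of_nonpos (inv_nonneg.2 hpos.le) (hmin w hw)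
  have huv : inner ℝ (‖u - v‖⁻¹ • (u - v)) (u - v) = ‖u - v‖ := by
    rw [real_inner_smul_left, real_inner_self_eq_norm_sq]
    field_simp
  rw [inner_sub_right] at hwv huv
  linarith

section

variable {M N : Type*} [CStarAlgebra M] [CStarAlgebra N] {κ : Type*}

namespace State

/-- The values of a state on a finite family of elements, as a point of Euclidean space. Only real
parts are recorded, so this is meant for self-adjoint elements. -/
def values (y : κ → N) (t : State N) : EuclideanSpace ℝ κ := WithLp.toLp 2 fun k => (t.1 (y k)).re

lemma isCompact_range_values [Finite κ] (y : κ → N) : IsCompact (Set.range (values y)) :=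
  isCompact_range <| (PiLp.continuous_toLp 2 _).comp <| continuous_pi fun k =>
    Complex.continuous_re.comp ((WeakDual.eval_continuous (y k)).comp continuous_subtype_val)

lemma convex_range_values (y : κ → N) : Convex ℝ (Set.range (values y)) := by
  rintro _ ⟨s, rfl⟩ _ ⟨t, rfl⟩ a b ha hb hab
  have hst : IsUnitalPositiveMap ((a : ℂ) • s.toLinearMap + (b : ℂ) • t.toLinearMap) :=
    ⟨(s.isUnitalPositiveMap.isPositiveMap.smul ha).add
        (t.isUnitalPositiveMap.isPositiveMap.smul hb),
      by simp [s.map_one, t.map_one, ← Complex.ofReal_add, hab]⟩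
  refine ⟨ofUnitalPositiveMap hst, ?_⟩
  ext k
  simp [values]

lemma re_apply_sum_smul [Fintype κ] (y : κ → N) (t : State N) (c : EuclideanSpace ℝ κ) :
    (t.1 (∑ k, c k • y k)).re = inner ℝ c (values y t) := by
  simp [PiLp.inner_apply, values, map_sum, mul_comm, ← Complex.coe_smul]

lemma re_apply_smul_one_add (t : State N) (r : ℝ) (a : N) :
    (t.1 (r • 1 + a)).re = r + (t.1 a).re := by
  rw [map_add, Complex.add_re, t.map_smul_one, Complex.ofReal_re]

/- Take a state attaining the norm of the positive element `ψ (r • 1 + h)`. -/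
lemma exists_re_apply_le_add [Nontrivial N] (s : State M) {ψ : M →ₗ[ℂ] N} (h1 : ψ 1 = 1)
    (hstar : ∀ a, ψ (star a) = star (ψ a)) {h : M} (hh : IsSelfAdjoint h) {r δ : ℝ}
    (hr : ‖ψ h‖ ≤ r) (hiso : ‖r • 1 + h‖ ≤ ‖ψ (r • 1 + h)‖ + δ) :
    ∃ t : State N, (s.1 h).re ≤ (t.1 (ψ h)).re + δ := by
  have hmap : ψ (r • 1 + h) = r • 1 + ψ h := by rw [map_add, ψ.map_smul_of_tower, h1]
  have hψh : IsSelfAdjoint (ψ h) := by rw [isSelfAdjoint_iff, ← hstar, hh.star_eq]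
  have hpos : 0 ≤ r • 1 + ψ h := by
    rw [← Algebra.algebraMap_eq_smul_one, ← neg_le_iff_add_nonneg']
    exact (neg_le_neg (algebraMap_mono N hr)).trans hψh.neg_algebraMap_norm_le_self
  have _ := (IsSelfAdjoint.of_nonneg hpos).isStarNormal
  obtain ⟨t, ht⟩ := exists_apply_eq_of_mem_spectrum (r • 1 + ψ h)
    (CStarAlgebra.norm_mem_spectrum_of_nonneg hpos)
  refine ⟨t, ?_⟩
  have hsr := s.re_apply_smul_one_add r h
  have htr := t.re_apply_smul_one_add r (ψ h)
  rw [ht] at htr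
  have hsle := (Complex.re_le_norm _).trans
    (s.norm_apply_le ((IsSelfAdjoint.smul (.all r) (.one M)).add hh))
  rw [hmap] at hiso
  simp only [Complex.coe_algebraMap, Complex.ofReal_re] at htr
  linarith

lemma exists_forall_norm_sub_le [Nontrivial N] [Fintype κ] (s : State M) {ψ : M →ₗ[ℂ] N}
    (h1 : ψ 1 = 1) (hstar : ∀ a, ψ (star a) = star (ψ a)) {x : κ → M}
    (hx : ∀ k, IsSelfAdjoint (x k)) {r δ : ℝ}
    (hr : ∀ c : EuclideanSpace ℝ κ, ‖c‖ ≤ 1 → ‖ψ (∑ k, c k • x k)‖ ≤ r)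
    (hiso : ∀ c : EuclideanSpace ℝ κ, ‖c‖ ≤ 1 →
      ‖r • 1 + ∑ k, c k • x k‖ ≤ ‖ψ (r • 1 + ∑ k, c k • x k)‖ + δ) :
    ∃ t : State N, ∀ k, ‖t.1 (ψ (x k)) - s.1 (x k)‖ ≤ δ := by
  obtain ⟨_, ⟨t, rfl⟩, ht⟩ := exists_norm_sub_le_of_forall_inner_le
    (isCompact_range_values (ψ ∘ x)).isComplete (convex_range_values (ψ ∘ x)) (u := values x s)
    (δ := δ) fun c hc => by
      obtain ⟨t, ht⟩ := s.exists_re_apply_le_add h1 hstar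
        (isSelfAdjoint_sum _ fun k _ => IsSelfAdjoint.smul (.all (c k)) (hx k))
        (hr c hc) (hiso c hc)
      refine ⟨_, ⟨t, rfl⟩, ?_⟩
      simp only [map_sum ψ, ψ.map_smul_of_tower] at ht
      rwa [re_apply_sum_smul, re_apply_sum_smul] at ht
  refine ⟨t, fun k => le_trans ?_ ((PiLp.norm_apply_le _ k).trans ht)⟩
  have hψx : IsSelfAdjoint (ψ (x k)) := by rw [isSelfAdjoint_iff, ← hstar, (hx k).star_eq]
  rw [norm_sub_rev, ← s.coe_re_apply (hx k), ← t.coe_re_apply hψx, ← Complex.ofReal_sub,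
    Complex.norm_real]
  rfl

end State

lemma IsPositiveMap.eq_zero_or_exists_eq_smul_state {s : M →ₗ[ℂ] ℂ} (hs : IsPositiveMap s) :
    s = 0 ∨ ∃ (σ : ℝ) (t : State M), 0 < σ ∧ s = (σ : ℂ) • t.toLinearMap := by
  have hs1 : 0 ≤ s 1 := isPositiveMap_iff.1 hs 1 zero_le_one
  obtain ⟨σ, hσ, hσ1⟩ := RCLike.nonneg_iff_exists_ofReal.1 hs1
  rcases hσ.eq_or_lt with rfl | hσ
  · left
    ext x
    simpa [← hσ1] using hs.norm_map_le_two_mul x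
  · refine .inr ⟨σ, .ofUnitalPositiveMap (f := ((σ⁻¹ : ℝ) : ℂ) • s)
      ⟨hs.smul (inv_nonneg.2 hσ.le), by simp [← hσ1, hσ.ne']⟩, hσ, ?_⟩
    ext x
    simp [hσ.ne']

lemma norm_map_le_norm_realPart_add {E : Type*} [SeminormedAddCommGroup E] [NormedSpace ℂ E]
    (f : M →ₗ[ℂ] E) (x : M) : ‖f x‖ ≤ ‖f (ℜ x)‖ + ‖f (ℑ x)‖ := by
  conv_lhs => rw [← realPart_add_I_smul_imaginaryPart x, map_add, map_smul]
  exact (norm_add_le _ _).trans_eq (by rw [norm_smul, Complex.norm_I, one_mul])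

end

namespace IsAsymptoticEmbedding

variable {ι : Type*} {l : Filter ι} {M : Type*} {N : ι → Type*} [CStarAlgebra M]
  [∀ i, CStarAlgebra (N i)] {θ : ∀ i, M →ₗ[ℂ] N i} {κ : Type*}

lemma eventually_nontrivial [Nontrivial M] (hθ : IsAsymptoticEmbedding l θ) :
    ∀ᶠ i in l, Nontrivial (N i) := by
  filter_upwards [hθ.eventually_norm_le (.one M) one_half_pos] with i hi
  refine ⟨θ i 1, 0, fun h => ?_⟩
  rw [h, norm_zero, CStarRing.norm_one] at hi
  norm_num at hi

lemma eventually_exists_state [Finite κ] (hθ : IsAsymptoticEmbedding l θ) (h1 : ∀ i, θ i 1 = 1)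
    (s : State M) {x : κ → M} (hx : ∀ k, IsSelfAdjoint (x k)) {δ : ℝ} (hδ : 0 < δ) :
    ∀ᶠ i in l, ∃ t : State (N i), ∀ k, ‖t.1 (θ i (x k)) - s.1 (x k)‖ ≤ δ := by
  have _ := Fintype.ofFinite κ
  have _ : Nontrivial M := ⟨1, 0, fun h => by simpa [h] using s.map_one⟩
  obtain ⟨K, hK⟩ := hθ.exists_norm_map_le
  set r : ℝ := K * ∑ k, ‖x k‖
  let y : EuclideanSpace ℝ κ → M := fun c => r • 1 + ∑ k, c k • x k
  have hcompact : IsCompact (y '' Metric.closedBall 0 1) :=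
    (isCompact_closedBall _ _).image (by fun_prop)
  have hsa : ∀ a ∈ y '' Metric.closedBall 0 1, IsSelfAdjoint a := by
    rintro _ ⟨c, -, rfl⟩
    exact (IsSelfAdjoint.smul (.all r) (.one M)).add
      (isSelfAdjoint_sum _ fun k _ => IsSelfAdjoint.smul (.all (c k)) (hx k))
  filter_upwards [hθ.eventually_forall_norm_le hcompact hsa hδ, hθ.eventually_nontrivial]
    with i hi _
  refine s.exists_forall_norm_sub_le (h1 i) (hθ.map_star i) hx (fun c hc => ?_)
    fun c hc => hi _ ⟨c, by simpa using hc, rfl⟩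
  refine (hK i _).trans (mul_le_mul_of_nonneg_left (norm_sum_le_of_le _ fun k _ => ?_) K.2)
  rw [norm_smul]
  exact mul_le_of_le_one_left (norm_nonneg _) ((PiLp.norm_apply_le c k).trans hc)

lemma eventually_exists_isPositiveMap_functional [Finite κ] (hθ : IsAsymptoticEmbedding l θ)
    (h1 : ∀ i, θ i 1 = 1) {s : M →ₗ[ℂ] ℂ} (hs : IsPositiveMap s) (x : κ → M) {δ : ℝ}
    (hδ : 0 < δ) :
    ∀ᶠ i in l, ∃ t : N i →ₗ[ℂ] ℂ, IsPositiveMap t ∧ ∀ k, ‖t (θ i (x k)) - s (x k)‖ ≤ δ := by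
  rcases hs.eq_zero_or_exists_eq_smul_state with rfl | ⟨σ, s, hσ, rfl⟩
  · exact .of_forall fun i => ⟨0, fun a => ⟨0, by simp⟩, by simpa using fun _ => hδ.le⟩
  let parts : κ ⊕ κ → selfAdjoint M := Sum.elim (fun k => ℜ (x k)) fun k => ℑ (x k)
  filter_upwards [hθ.eventually_exists_state h1 s (fun k => (parts k).2)
    (show 0 < δ / (2 * σ) by positivity)] with i ⟨t, ht⟩
  refine ⟨(σ : ℂ) • t.toLinearMap, t.isUnitalPositiveMap.isPositiveMap.smul hσ.le, fun k => ?_⟩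
  calc ‖(σ : ℂ) * t.1 (θ i (x k)) - σ * s.1 (x k)‖
      = σ * ‖(t.toLinearMap ∘ₗ θ i - s.toLinearMap) (x k)‖ := by
        rw [← mul_sub, norm_mul, Complex.norm_real, Real.norm_of_nonneg hσ.le]
        rfl
    _ ≤ σ * (δ / (2 * σ) + δ / (2 * σ)) := by
        gcongr
        exact (norm_map_le_norm_realPart_add _ _).trans
          (add_le_add (ht (.inl k)) (ht (.inr k)))
    _ = δ := by field_simp; ring

end IsAsymptoticEmbedding

/-! ### Nuclear quasi-diagonal C*-algebras are pseudo-diagonal -/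

section Choi

variable {n : Type*} [Fintype n] {A : Type*} [CStarAlgebra A]

/-- The functional on matrices over `A` that corresponds, in Choi's correspondence, to a map `α`
from `A` into matrices. -/
def choiFunctional (α : A →ₗ[ℂ] CStarMatrix n n ℂ) : CStarMatrix n n A →ₗ[ℂ] ℂ where
  toFun M := ∑ i, ∑ j, α (M i j) i j
  map_add' M N := by simp [Finset.sum_add_distrib]
  map_smul' r M := by simp [Finset.mul_sum]

lemma sum_star_mul_self_apply_apply_nonneg (N : CStarMatrix n n (CStarMatrix n n ℂ)) :
    0 ≤ ∑ i, ∑ j, (star N * N) i j i j := by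
  have hentry : ∀ i j, (star N * N) i j i j = ∑ q : n × n, star (N q.1 i q.2 i) * N q.1 j q.2 j :=
    fun i j => by
      rw [CStarMatrix.mul_apply, Fintype.sum_prod_type]
      exact (Matrix.sum_apply i j _ _).trans (Finset.sum_congr rfl fun l _ => CStarMatrix.mul_apply)
  have hsq : ∑ i, ∑ j, (star N * N) i j i j =
      ∑ q : n × n, star (∑ i, N q.1 i q.2 i) * ∑ j, N q.1 j q.2 j := by
    simp only [hentry, star_sum, Finset.sum_mul_sum]
    rw [Finset.sum_comm_cycle, Finset.sum_comm_cycle]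
  rw [hsq]
  exact Finset.sum_nonneg fun q _ => star_mul_self_nonneg _

lemma IsCompletelyPositive.isPositiveMap_choiFunctional {k : ℕ}
    {α : A →ₗ[ℂ] CStarMatrix (Fin k) (Fin k) ℂ} (hα : IsCompletelyPositive α) :
    IsPositiveMap (choiFunctional α) := by
  rw [isPositiveMap_complex_iff]
  intro M
  obtain ⟨N, hN⟩ := hα k M
  refine (sum_star_mul_self_apply_apply_nonneg N).trans_eq ?_
  rw [← hN]
  rfl

variable [DecidableEq n]

lemma choiFunctional_singleEntry (α : A →ₗ[ℂ] CStarMatrix n n ℂ) (i j : n) (a : A) :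
    choiFunctional α (singleEntry i j a) = α a i j := by
  have hentry : ∀ p q, α (singleEntry i j a p q) p q = if i = p then if j = q then α a p q else 0
      else 0 := fun p q => by
    rw [singleEntry_apply, ite_and]
    split_ifs <;> simp
  simp [choiFunctional, hentry]

omit [Fintype n] in
/-- The map from `A` into matrices that corresponds to a functional on matrices over `A`; inverse to
`choiFunctional`. -/
def choiMap (t : CStarMatrix n n A →ₗ[ℂ] ℂ) : A →ₗ[ℂ] CStarMatrix n n ℂ where
  toFun a := CStarMatrix.ofMatrix fun i j => t (singleEntry i j a)
  map_add' a b := by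
    ext i j
    exact (congrArg t (map_add _ a b)).trans (map_add t _ _)
  map_smul' r a := by
    ext i j
    exact (congrArg t (map_smul _ r a)).trans (map_smul t _ _)

lemma star_mul_self_sum_smul_singleEntry (p : n) (c : n → ℂ) (a : A) :
    star (∑ j, c j • singleEntry p j a) * ∑ j, c j • singleEntry p j a =
      ∑ i, ∑ j, (star (c i) * c j) • singleEntry i j (star a * a) := by
  simp only [star_sum, Finset.sum_mul_sum, star_smul, star_singleEntry, smul_mul_smul_comm,
    singleEntry_mul_singleEntry]

open scoped MatrixOrder in
lemma IsPositiveMap.choiMap {t : CStarMatrix n n A →ₗ[ℂ] ℂ} (ht : IsPositiveMap t) :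
    IsPositiveMap (choiMap t) := by
  intro a
  have hpos : Matrix.PosSemidef (Matrix.of fun i j => t (singleEntry i j (star a * a))) := by
    refine .of_dotProduct_mulVec_nonneg ?_ fun c => ?_
    · ext i j
      refine (ht.map_star _).symm.trans ?_
      rw [star_singleEntry, star_mul, star_star, Matrix.of_apply]
    rcases isEmpty_or_nonempty n with _ | ⟨⟨p⟩⟩
    · simp
    have hsq := isPositiveMap_complex_iff.1 ht (∑ j, c j • singleEntry p j a)
    rw [star_mul_self_sum_smul_singleEntry] at hsq
    refine hsq.trans_eq ?_
    simp only [map_sum, _root_.map_smul, smul_eq_mul, dotProduct, Matrix.mulVec, Finset.mul_sum,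
      Matrix.of_apply, Pi.star_apply]
    exact Finset.sum_congr rfl fun i _ => Finset.sum_congr rfl fun j _ => by ring
  obtain ⟨N, hN⟩ := CStarAlgebra.nonneg_iff_eq_star_mul_self.1 hpos.nonneg
  exact ⟨CStarMatrix.ofMatrix N, hN⟩

end Choi

section

variable {ι : Type*} {l : Filter ι} {A : Type*} {B : ι → Type*} [CStarAlgebra A]
  [∀ i, CStarAlgebra (B i)] {θ : ∀ i, A →ₗ[ℂ] B i}

/- Through Choi's correspondence, it suffices to extend the functional of `α` approximately along
the amplifications of the `θ i`. -/
lemma IsAsymptoticEmbedding.eventually_exists_isPositiveMap (hθ : IsAsymptoticEmbedding l θ)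
    (hpos : ∀ i, IsUnitalPositiveMap (θ i)) {k : ℕ} {α : A →ₗ[ℂ] CStarMatrix (Fin k) (Fin k) ℂ}
    (hα : IsCompletelyPositive α) (S : Finset A) {δ : ℝ} (hδ : 0 < δ) :
    ∀ᶠ i in l, ∃ γ : B i →ₗ[ℂ] CStarMatrix (Fin k) (Fin k) ℂ,
      IsPositiveMap γ ∧ ∀ a ∈ S, ‖γ (θ i a) - α a‖ ≤ δ := by
  let x : S × Fin k × Fin k → CStarMatrix (Fin k) (Fin k) A := fun p =>
    singleEntry p.2.1 p.2.2 (p.1 : A)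
  filter_upwards [hθ.mapₗ.eventually_exists_isPositiveMap_functional
    (fun i => (hpos i).mapₗ_one) hα.isPositiveMap_choiFunctional x
    (show 0 < δ / (k ^ 2 + 1) by positivity)] with i ⟨t, ht, hclose⟩
  refine ⟨choiMap t, ht.choiMap, fun a ha => ?_⟩
  have hentry : ∀ p q, ‖(choiMap t (θ i a) - α a) p q‖ ≤ δ / (k ^ 2 + 1) := fun p q => by
    have hpq := hclose (⟨a, ha⟩, p, q)
    rwa [mapₗ_singleEntry, choiFunctional_singleEntry] at hpq
  refine (norm_le_card_sq_mul hentry).trans ?_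
  rw [Fintype.card_fin, mul_div_assoc', div_le_iff₀ (by positivity)]
  nlinarith

lemma norm_sub_inv_one_add_smul_le {E : Type*} [SeminormedAddCommGroup E] [NormedSpace ℂ E] {x : E}
    {δ K : ℝ} (hδ : 0 ≤ δ) (hx : ‖x‖ ≤ (1 + δ) * K) :
    ‖x - (((1 + δ)⁻¹ : ℝ) : ℂ) • x‖ ≤ δ * K := by
  have hδ1 : 1 - (1 + δ)⁻¹ = δ * (1 + δ)⁻¹ := by field_simp; ring
  have hsplit : x - (((1 + δ)⁻¹ : ℝ) : ℂ) • x = ((δ * (1 + δ)⁻¹ : ℝ) : ℂ) • x := by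
    rw [← hδ1, Complex.ofReal_sub, Complex.ofReal_one, sub_smul, one_smul]
  calc ‖x - (((1 + δ)⁻¹ : ℝ) : ℂ) • x‖ = δ * (1 + δ)⁻¹ * ‖x‖ := by
        rw [hsplit, norm_smul, Complex.norm_real, Real.norm_of_nonneg (by positivity)]
    _ ≤ δ * (1 + δ)⁻¹ * ((1 + δ) * K) := by gcongr
    _ = δ * K := by field_simp

/- Scaling `φ` by `(1 + δ)⁻¹` makes it contractive at `1`, so that it can be unitalized. -/
lemma IsPositiveMap.exists_isUnitalPositiveMap_norm_sub_le {M N : Type*} [CStarAlgebra M]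
    [CStarAlgebra N] {φ : N →ₗ[ℂ] M} (hφ : IsPositiveMap φ) (ω : State N) {δ : ℝ}
    (h1 : ‖1 - φ 1‖ ≤ δ) :
    ∃ φ' : N →ₗ[ℂ] M, IsUnitalPositiveMap φ' ∧ ∀ b, ‖φ b - φ' b‖ ≤ 6 * δ * ‖b‖ := by
  have hδ : 0 ≤ δ := (norm_nonneg _).trans h1
  set r : ℝ := (1 + δ)⁻¹
  have hr0 : 0 ≤ r := by positivity
  have hφ1 : ‖φ 1‖ ≤ 1 + δ := by
    have := norm_le_norm_add_norm_sub (1 : M) (φ 1)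
    linarith [(IsStarProjection.one M).norm_le]
  have hcontr : ‖(r : ℂ) • φ 1‖ ≤ 1 := by
    rw [norm_smul, Complex.norm_real, Real.norm_of_nonneg hr0]
    exact inv_mul_le_one_of_le₀ hφ1 (by positivity)
  have hdefect : ‖1 - (r : ℂ) • φ 1‖ ≤ δ + δ * 1 :=
    (norm_sub_le_norm_sub_add_norm_sub _ _ _).trans
      (add_le_add h1 (norm_sub_inv_one_add_smul_le hδ (by rwa [mul_one])))
  have hscale : ∀ b, ‖φ b - (r : ℂ) • φ b‖ ≤ δ * (2 * ‖b‖) := fun b =>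
    norm_sub_inv_one_add_smul_le hδ <| (hφ.norm_map_le_two_mul b).trans <| by
      rw [mul_left_comm, ← mul_assoc]
      gcongr
  refine ⟨unitalize ((r : ℂ) • φ) ω, isUnitalPositiveMap_unitalize (hφ.smul hr0) hcontr ω,
    fun b => ?_⟩
  calc ‖φ b - unitalize ((r : ℂ) • φ) ω b‖
      ≤ ‖φ b - (r : ℂ) • φ b‖ + ‖unitalize ((r : ℂ) • φ) ω b - (r : ℂ) • φ b‖ := by
        rw [norm_sub_rev (unitalize _ _ _)]
        exact norm_sub_le_norm_sub_add_norm_sub _ _ _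
    _ ≤ δ * (2 * ‖b‖) + 2 * ‖b‖ * (δ + δ * 1) := by
        refine add_le_add (hscale b) ((norm_unitalize_sub_le _ ω b).trans ?_)
        gcongr
        exact hdefect
    _ = 6 * δ * ‖b‖ := by ring

namespace IsNuclear

lemma eventually_exists_isPositiveMap (hA : IsNuclear A) (hθ : IsAsymptoticEmbedding l θ)
    (hpos : ∀ i, IsUnitalPositiveMap (θ i)) (S : Finset A) {δ : ℝ} (hδ : 0 < δ) :
    ∀ᶠ i in l, ∃ φ : B i →ₗ[ℂ] A, IsPositiveMap φ ∧ ∀ a ∈ S, ‖a - φ (θ i a)‖ ≤ δ := by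
  obtain ⟨k, α, β, hα, hβ, hαβ⟩ := hA (δ / 2) (half_pos hδ) S
  filter_upwards [hθ.eventually_exists_isPositiveMap hpos hα.1 S (half_pos hδ)] with i ⟨γ, hγ, hγα⟩
  refine ⟨β ∘ₗ γ, hβ.1.isPositiveMap.comp hγ, fun a ha => ?_⟩
  calc ‖a - β (γ (θ i a))‖ ≤ ‖a - β (α a)‖ + ‖β (α a) - β (γ (θ i a))‖ :=
        norm_sub_le_norm_sub_add_norm_sub _ _ _
    _ ≤ δ / 2 + δ / 2 := by
        refine add_le_add (hαβ a ha) ?_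
        rw [← map_sub]
        exact (hβ.2 _).trans (norm_sub_rev (γ (θ i a)) _ ▸ hγα a ha)
    _ = δ := add_halves δ

lemma eventually_exists_isUnitalPositiveMap [Nontrivial A] (hA : IsNuclear A)
    (hθ : IsAsymptoticEmbedding l θ) (hpos : ∀ i, IsUnitalPositiveMap (θ i)) (S : Finset A) {ε : ℝ}
    (hε : 0 < ε) :
    ∀ᶠ i in l, ∃ φ : B i →ₗ[ℂ] A, IsUnitalPositiveMap φ ∧ ∀ a ∈ S, ‖a - φ (θ i a)‖ ≤ ε := by
  classical
  obtain ⟨R, hR, hSR⟩ : ∃ R : ℝ, 0 ≤ R ∧ ∀ a ∈ S, ‖a‖ ≤ R :=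
    ⟨∑ a ∈ S, ‖a‖, Finset.sum_nonneg fun _ _ => norm_nonneg _,
      fun a ha => Finset.single_le_sum (f := fun a : A => ‖a‖) (fun _ _ => norm_nonneg _) ha⟩
  set δ : ℝ := ε / (1 + 12 * R)
  filter_upwards [hθ.eventually_nontrivial, hA.eventually_exists_isPositiveMap hθ hpos (insert 1 S)
    (show 0 < δ by positivity)] with i _ ⟨φ, hφ, hclose⟩
  obtain ⟨ω⟩ : Nonempty (State (B i)) := inferInstance
  obtain ⟨φ', hφ', hφφ'⟩ := hφ.exists_isUnitalPositiveMap_norm_sub_le ω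
    (by simpa only [(hpos i).map_one] using hclose 1 (by simp))
  refine ⟨φ', hφ', fun a ha => ?_⟩
  calc ‖a - φ' (θ i a)‖ ≤ ‖a - φ (θ i a)‖ + ‖φ (θ i a) - φ' (θ i a)‖ :=
        norm_sub_le_norm_sub_add_norm_sub _ _ _
    _ ≤ δ + 6 * δ * (2 * R) := by
        refine add_le_add (hclose a (by simp [ha])) ((hφφ' _).trans ?_)
        gcongr
        exact ((hpos i).norm_map_le_two_mul a).trans (by gcongr; exact hSR a ha)
    _ = ε := by simp only [δ]; field_simp; ring

theorem isPseudoDiagonal {A : Type u} [CStarAlgebra A] (hA : IsNuclear A)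
    (hq : IsQuasiDiagonal A) : IsPseudoDiagonal A := by
  classical
  intro ε hε S
  rcases subsingleton_or_nontrivial A with _ | _
  · have hnorm : ∀ a : A, ‖a‖ ≤ ε := fun a => by simpa [Subsingleton.elim a 0] using hε.le
    exact ⟨A, inferInstance, Module.Finite.of_finite, .id, .id, .id, rfl, .id, rfl,
      fun _ _ => hnorm _, fun _ _ _ _ => hnorm _, fun _ _ _ _ => hnorm _⟩
  obtain ⟨B, _, _, θ, hpos, hθ⟩ := hq.exists_isUnitalPositiveMap
  have hmul : ∀ᶠ i in atTop, ∀ a ∈ S, ∀ b ∈ S, ‖θ i (a * b) - θ i a * θ i b‖ ≤ ε :=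
    (Finset.eventually_all _).2 fun a _ => (Finset.eventually_all _).2 fun b _ =>
      ((hθ.map_mul a b).eventually_lt_const hε).mono fun _ h => h.le
  obtain ⟨i, ⟨φ, hφ, hφθ⟩, hi⟩ :=
    ((hA.eventually_exists_isUnitalPositiveMap hθ hpos S hε).and hmul).exists
  have hprod : ∀ c ∈ jordanLieCoeffs, ∀ a ∈ S, ∀ b ∈ S,
      ‖θ i (hermProd c a b) - hermProd c (θ i a) (θ i b)‖ ≤ ε := fun c hc a ha b hb =>
    norm_map_hermProd_sub_le (θ i) (norm_eq_of_mem_jordanLieCoeffs hc).le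
      (hi a ha b hb) (hi b hb a ha)
  refine ⟨B i, inferInstance, inferInstance, φ, θ i, hφ.isPositiveMap, hφ.map_one,
    (hpos i).isPositiveMap, (hpos i).map_one, hφθ, ?_⟩
  rw [← hermProd_two_inv, ← hermProd_two_inv, ← hermProd_two_I_inv, ← hermProd_two_I_inv]
  exact ⟨hprod _ (.inl rfl), hprod _ (.inr rfl)⟩

end IsNuclear

end

end QuantumMetric

end

theorem mainTheorem4 :
    (∀ (C D : ℝ≥0), 1 ≤ C → ∀ X : CStarPair.{u}, IsCDQuasiLeibnizQCMS C D X →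
      IsPseudoDiagonal X →
      ∀ ε : ℝ≥0, 0 < ε → IsLimitOfFiniteDimensional (C * (1 + ε)) (D + ε) X) ∧
    (∀ (C D : ℝ≥0), 1 ≤ C → ∀ X : CStarPair.{u}, IsCDQuasiLeibnizQCMS C D X →
      IsNuclear X → IsQuasiDiagonal X →
      ∀ ε : ℝ≥0, 0 < ε → IsLimitOfFiniteDimensional (C * (1 + ε)) (D + ε) X) ∧
    (∀ X : CStarPair.{u}, IsLeibnizQCMS X →
      IsNuclear X → IsQuasiDiagonal X →
      ∀ ε : ℝ≥0, 0 < ε → IsLimitOfFiniteDimensional (1 + ε) ε X) := by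
  have of_isPseudoDiagonal : ∀ (C D : ℝ≥0), 1 ≤ C → ∀ X : CStarPair.{u},
      IsCDQuasiLeibnizQCMS C D X → IsPseudoDiagonal X →
      ∀ ε : ℝ≥0, 0 < ε → IsLimitOfFiniteDimensional (C * (1 + ε)) (D + ε) X :=
    fun C D hC X hX hA ε hε => isLimitOfFiniteDimensional_of_isPseudoDiagonal hC hX hA
      (le_mul_of_one_le_right' (le_add_of_nonneg_right ε.2)) (lt_add_of_pos_right D hε)
  refine ⟨of_isPseudoDiagonal, fun C D hC X hX hA hq =>
    of_isPseudoDiagonal C D hC X hX (hA.isPseudoDiagonal hq), fun X hX hA hq ε hε => ?_⟩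
  rw [IsLeibnizQCMS, leibnizFun_eq_cdFun] at hX
  simpa using of_isPseudoDiagonal 1 0 le_rfl X hX (hA.isPseudoDiagonal hq) ε hε
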